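/- Let $d\ge 1$, $n\ge 0$, and let $\lambda=(\lambda_1\ge\dots\ge\lambda_k>0)$ be a partition of $n$ with exactly $k\le d$ parts. Label the $n$ tensor factors of $(\mathbb C^d)^{\otimes n}$ by the boxes of the Young diagram of $\lambda$ (left to right, then top to bottom). For a permutation $\pi$ of the boxes let $P_\pi$ be the operator permuting the tensor factors accordingly, let $A_\lambda$ (resp. $B_\lambda$) be the group of permutations preserving every row (resp. column), let $Y_\lambda=\sum_{a\in A_\lambda}P_a\sum_{b\in B_\lambda}\mathrm{sgn}(b)P_b$ be the Young symmetrizer, and let $\Pi^{(\lambda)}_{\mathrm{sym}}=\frac1{|A_\lambda|}\sum_{\pi\in A_\lambda}P_\pi$ be the projector onto the $\lambda$-row-symmetric subspace $\{v: P_\pi v=v\ \forall \pi\in A_\lambda\}$. For $w\in\mathbb Z_{\ge0}^d$ let $V(w)$ be the span of the standard basis vectors $|a_1,\dots,a_n\rangle$ in which each symbol $i\in\{1,\dots,d\}$ occurs exactly $w_i$ times. Let $\mu_H$ be the Haar measure on pure states (the law of $U|0\rangle\langle 0|U^\dagger$ for $U$ Haar random in $U(d)$, where $|0\rangle$ is a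 fixed standard basis vector), and let $\kappa_s=\binom{s+d-1}{d-1}$. The row-symmetric joint measurement $\mathcal M^{(\lambda)}$ is the POVM with elements $$F^{(\lambda)}(\psi_1,\dots,\psi_k)\,d\mu_H^k(\psi_1,\dots,\psi_k),\qquad F^{(\lambda)}(\psi_1,\dots,\psi_k)=\bigotimes_{i=1}^k\kappa_{\lambda_i}\psi_i^{\otimes\lambda_i},$$ where $\psi_i^{\otimes \lambda_i}$ acts on the $i$-th row, together with the "fail" element $I-\Pi^{(\lambda)}_{\mathrm{sym}}$. On the outcome $(\psi_1,\dots,\psi_k)$ put $\Psi=\sum_{i=1}^k(d+\lambda_i)\psi_i$ (and, say, $\Psi=0$ on "fail"). The image of $Y_\lambda$ is contained in the $\lambda$-row-symmetric subspace. Moreover, there are absolute constants $C_1,C_2$ (independent of $d,n,k,\lambda$ and of all the data below) such that the following holds. Let $|\tau\rangle$ be a unit vector lying in some weight subspace $V(w)$ and in the $\lambda$-row-symmetric subspace (for example a unit vector of $V(w)$ in the image of $Y_\lambda$, as produced by the preprocessing step), let $U\in U(d)$, and let $O\in\mathbb C^{d\times d}$ be Hermitian. If $\mathcal M^{(\lambda)}$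 is performed on $U^{\otimes n}|\tau\rangle$, then the outcome law is a probability measure, "fail" has probability $0$, $\mathrm{tr}(O\Psi)$ is almost surely real and square integrable, and $$\mathrm{Var}[\mathrm{tr}(O\Psi)]=\mathbb E[\mathrm{tr}(O\Psi)^2]-\mathbb E[\mathrm{tr}(O\Psi)]^2\le k\,\mathrm{tr}(O^2)+C_1\,n\,\|O^2\|_\infty+C_2\,n^2\,\|O\|_\infty^2,$$ where $\|\cdot\|_\infty$ is the spectral norm. -/

import Mathlib

open MeasureTheory ProbabilityTheory

noncomputable section

namespace RowSymShadow

/-! ### Qudits indexed by the boxes of a Young diagram -/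

/-- The boxes `(i, p)` of the Young diagram with rows of lengths `lam 0, …, lam (k-1)`.
The `n = ∑ i, lam i` qudits are labelled by these boxes: `⟨i, p⟩` is the `p`-th qudit in row `i`. -/
abbrev Box {k : ℕ} (lam : Fin k → ℕ) : Type := Σ i : Fin k, Fin (lam i)

/-- `(ℂ^d)^{⊗ n}` with the qudits labelled by the finite type `B`, in coordinates with respect to
the standard basis vectors `|a⟩`, `a : B → Fin d`. -/
abbrev QuditSpace (B : Type) (d : ℕ) : Type := (B → Fin d) → ℂ

/-- Operators on `(ℂ^d)^{⊗ n}`, as matrices in the standard basis. -/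
abbrev QuditOp (B : Type) (d : ℕ) : Type := Matrix (B → Fin d) (B → Fin d) ℂ

/-- The tensor product `⨂_b M b` of one-qudit operators. -/
def tensorOp {B : Type} [Fintype B] {d : ℕ} (M : B → Matrix (Fin d) (Fin d) ℂ) : QuditOp B d :=
  Matrix.of fun a a' => ∏ b, M b (a b) (a' b)

/-- The operator `P_π`, which sends `|a⟩` to `|a ∘ π⁻¹⟩`. -/
def permOp {B : Type} [Fintype B] [DecidableEq B] {d : ℕ} (π : Equiv.Perm B) : QuditOp B d :=
  Matrix.of fun a a' => if a = a' ∘ π.symm then 1 else 0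

/-- The weight vector of the standard basis vector `|a⟩`: how often each symbol occurs. -/
def weight {B : Type} [Fintype B] {d : ℕ} (a : B → Fin d) : Fin d → ℕ :=
  fun i => (Finset.univ.filter fun b => a b = i).card

/-- The weight subspace `V(w)`, spanned by the standard basis vectors of weight `w`. -/
def weightSpace {B : Type} [Fintype B] [DecidableEq B] {d : ℕ} (w : Fin d → ℕ) :
    Submodule ℂ (QuditSpace B d) :=
  Submodule.span ℂ {v | ∃ a : B → Fin d, weight a = w ∧ v = Pi.single a 1}

/-- The row group `A_λ`: permutations of the boxes that preserve every row. -/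
def rowGroup {k : ℕ} (lam : Fin k → ℕ) : Finset (Equiv.Perm (Box lam)) :=
  Finset.univ.filter fun π => ∀ b, (π b).1 = b.1

/-- The column group `B_λ`: permutations of the boxes that preserve every column. -/
def colGroup {k : ℕ} (lam : Fin k → ℕ) : Finset (Equiv.Perm (Box lam)) :=
  Finset.univ.filter fun π => ∀ b, ((π b).2 : ℕ) = (b.2 : ℕ)

/-- The Young symmetrizer `Y_λ = (∑_{a ∈ A_λ} P_a) (∑_{b ∈ B_λ} sgn(b) P_b)`. -/
def youngSymmetrizer {k : ℕ} (lam : Fin k → ℕ) (d : ℕ) : QuditOp (Box lam) d :=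
  (∑ π ∈ rowGroup lam, permOp π) *
    (∑ σ ∈ colGroup lam, ((Equiv.Perm.sign σ : ℤ) : ℂ) • permOp σ)

/-- The `λ`-row-symmetric subspace: the vectors fixed by `P_π` for every `π ∈ A_λ`. -/
def rowSymSpace {k : ℕ} (lam : Fin k → ℕ) (d : ℕ) : Submodule ℂ (QuditSpace (Box lam) d) where
  carrier := {v | ∀ π ∈ rowGroup lam, (permOp π).mulVec v = v}
  add_mem' := by
    intro v w hv hw π hπ
    rw [Matrix.mulVec_add, hv π hπ, hw π hπ]
  zero_mem' := by
    intro π _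
    exact Matrix.mulVec_zero _
  smul_mem' := by
    intro c v hv π hπ
    rw [Matrix.mulVec_smul, hv π hπ]

/-- `Π_sym^{(λ)} = |A_λ|⁻¹ ∑_{π ∈ A_λ} P_π`, the projector onto the row-symmetric subspace. -/
def rowSymProj {k : ℕ} (lam : Fin k → ℕ) (d : ℕ) : QuditOp (Box lam) d :=
  ((rowGroup lam).card : ℂ)⁻¹ • ∑ π ∈ rowGroup lam, permOp π

/-- The rank-one operator `|φ⟩⟨φ|`. -/
def ketbra {ι : Type} (φ : ι → ℂ) : Matrix ι ι ℂ :=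
  Matrix.vecMulVec φ (star φ)

/-- The density operator of the pure state `U^{⊗ n} |τ⟩`. -/
def rotatedState {B : Type} [Fintype B] [DecidableEq B] {d : ℕ} (U : Matrix.unitaryGroup (Fin d) ℂ)
    (τ : QuditSpace B d) : QuditOp B d :=
  ketbra ((tensorOp fun _ : B => (U : Matrix (Fin d) (Fin d) ℂ)).mulVec τ)

/-! ### Haar random pure states -/

/-- Complex matrices carry the product (equivalently Borel) sigma-algebra of their entries. -/
instance matrixMeasurableSpace (d : ℕ) : MeasurableSpace (Matrix (Fin d) (Fin d) ℂ) :=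
  inferInstanceAs (MeasurableSpace (Fin d → Fin d → ℂ))

instance matrixBorelSpace (d : ℕ) : BorelSpace (Matrix (Fin d) (Fin d) ℂ) :=
  inferInstanceAs (BorelSpace (Fin d → Fin d → ℂ))

instance unitaryCompactSpace (d : ℕ) : CompactSpace (Matrix.unitaryGroup (Fin d) ℂ) := by
  have hcl : IsClosed ((Matrix.unitaryGroup (Fin d) ℂ : Submonoid (Matrix (Fin d) (Fin d) ℂ)) :
      Set (Matrix (Fin d) (Fin d) ℂ)) := isClosed_unitary
  have hc : IsCompact (Set.univ.pi fun _ : Fin d => Set.univ.pi fun _ : Fin d =>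
      Metric.closedBall (0 : ℂ) 1) :=
    isCompact_univ_pi fun _ => isCompact_univ_pi fun _ => isCompact_closedBall 0 1
  have hsub : ((Matrix.unitaryGroup (Fin d) ℂ : Submonoid (Matrix (Fin d) (Fin d) ℂ)) :
      Set (Matrix (Fin d) (Fin d) ℂ)) ⊆
      (Set.univ.pi fun _ : Fin d => Set.univ.pi fun _ : Fin d =>
        Metric.closedBall (0 : ℂ) 1) := by
    intro U hU i _ j _
    simpa using entry_norm_bound_of_unitary hU i j
  exact isCompact_iff_compactSpace.mp (hc.of_isClosed_subset hcl hsub)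

/-- The Haar probability measure `ν_H` on the unitary group `U(d)`. -/
def haarUnitary (d : ℕ) : Measure (Matrix.unitaryGroup (Fin d) ℂ) :=
  Measure.haarMeasure ⊤

/-- The Haar random state measure `μ_H`: the law of the density matrix `U |0⟩⟨0| U†` of a pure
state, for a Haar random unitary `U`. -/
def haarState (d : ℕ) [NeZero d] : Measure (Matrix (Fin d) (Fin d) ℂ) :=
  (haarUnitary d).map fun U : Matrix.unitaryGroup (Fin d) ℂ =>
    (U : Matrix (Fin d) (Fin d) ℂ) * ketbra (Pi.single (0 : Fin d) 1) *
      (U : Matrix (Fin d) (Fin d) ℂ).conjTranspose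

/-! ### The row-symmetric joint measurement and the estimator -/

/-- `κ_s`, the dimension of the symmetric subspace of `s` qudits. -/
def symDim (d s : ℕ) : ℕ := Nat.choose (s + d - 1) (d - 1)

/-- The POVM element `F^{(λ)}(ψ_1, …, ψ_k) = ⨂_i κ_{λ_i} ψ_i^{⊗ λ_i}`. -/
def povmElement {k : ℕ} (lam : Fin k → ℕ) {d : ℕ} (ψ : Fin k → Matrix (Fin d) (Fin d) ℂ) :
    QuditOp (Box lam) d :=
  ((∏ i, symDim d (lam i) : ℕ) : ℂ) • tensorOp fun b : Box lam => ψ b.1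

/-- Measurement outcomes: a tuple `(ψ_1, …, ψ_k)`, or the outcome "fail". -/
abbrev Outcome (k d : ℕ) : Type := (Fin k → Matrix (Fin d) (Fin d) ℂ) ⊕ Unit

/-- The law of the outcome when the row-symmetric joint measurement is performed on the density
operator `ρ` (Born rule): on tuples it has density `tr (F^{(λ)}(ψ) ρ)` with respect to `μ_H^k`, and
"fail" has probability `tr ((I - Π_sym^{(λ)}) ρ)`. -/
def outcomeLaw {k : ℕ} (lam : Fin k → ℕ) (d : ℕ) [NeZero d] (ρ : QuditOp (Box lam) d) :
    Measure (Outcome k d) :=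
  ((Measure.pi fun _ : Fin k => haarState d).withDensity fun ψ =>
      ENNReal.ofReal (povmElement lam ψ * ρ).trace.re).map Sum.inl +
    ENNReal.ofReal ((1 - rowSymProj lam d) * ρ).trace.re • Measure.dirac (Sum.inr ())

/-- The estimator `Ψ = ∑_i (d + λ_i) ψ_i` (by convention `0` on the outcome "fail"). -/
def estimator {k : ℕ} (lam : Fin k → ℕ) (d : ℕ) : Outcome k d → Matrix (Fin d) (Fin d) ℂ
  | Sum.inl ψ => ∑ i, ((d : ℂ) + (lam i : ℂ)) • ψ i
  | Sum.inr _ => 0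

/-- The real random variable `tr (O Ψ)`. -/
def traceEstimator {k : ℕ} (lam : Fin k → ℕ) {d : ℕ} (O : Matrix (Fin d) (Fin d) ℂ) :
    Outcome k d → ℝ :=
  fun ω => (O * estimator lam d ω).trace.re

/-- The spectral norm of a matrix: the operator norm on `ℂ^d` with its Euclidean norm. -/
def specNorm {d : ℕ} (M : Matrix (Fin d) (Fin d) ℂ) : ℝ :=
  ‖Matrix.toEuclideanCLM (𝕜 := ℂ) M‖

end RowSymShadow

end

open RowSymShadow

/-!
A pure state `|φ⟩ = U|0⟩` enters through the coordinates `⟨φ|x⟩` of its bra. A vector `v` of qudits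
coloured by `r` becomes the polynomial `⟨⨂_b φ_{r b}|v⟩` in the bras' coordinates, and for
`r`-symmetric `v` the outcome density is `∏_i κ_{m_i}` times its squared modulus, `m_i` being the
number of qudits of colour `i`.

Haar measure is invariant under infinitesimal unitaries, so integrating over it turns the action of
`𝔤𝔩_d` on polynomials into a `*`-representation. Since `∑_x ⟨φ|x⟩⟨x|φ⟩ = 1`, Euler's identity then
makes `∂_x` adjoint to multiplication by `(d + m) ⟨φ|x⟩` on polynomials of degree `m`. This gives
Wick's rule, hence the isometry between `r`-symmetric vectors and polynomials; and it turns
multiplication by `(d + m) ⟨φ|A|φ⟩` into the action of `A` shifted by `tr A`.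

The mean of the estimator is therefore the expectation of the one-body operator of `O`, shifted by
`k tr O`. Its second moment is the expectation of the square of that operator, plus that of the
shifted one-body operator of `O²`, minus the nonnegative term `∑_i (d + m_i) E[⟨φ_i|O|φ_i⟩²]`. The
shift by `k tr O` cancels in the variance, and the shift by `k tr O²` is its leading term.
-/

noncomputable section

namespace RowSymShadow

section

open MvPolynomial

open scoped Nat

/-! ### Haar integrals, derivations and multiplicities -/

lemma integral_eq_zero_of_hasDerivAt_mul_left {G : Type*} [Group G] [TopologicalSpace G]
    [ContinuousMul G] [CompactSpace G] [MeasurableSpace G] [BorelSpace G] {μ : Measure G}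
    [IsFiniteMeasure μ] [μ.IsMulLeftInvariant] {f f' : G → ℂ} (hf : Continuous f)
    (hf' : Continuous f') (γ : ℝ → G)
    (hγ : ∀ x t, HasDerivAt (fun s => f (γ s * x)) (f' (γ t * x)) t) :
    ∫ x, f' x ∂μ = 0 := by
  have integrable {g : G → ℂ} (hg : Continuous g) : Integrable g μ :=
    hg.integrable_of_hasCompactSupport (.of_compactSpace g)
  obtain ⟨C, hC⟩ := (isCompact_range hf').isBounded.exists_norm_le
  have hderiv : HasDerivAt (fun t => ∫ x, f (γ t * x) ∂μ) (∫ x, f' (γ 0 * x) ∂μ) 0 :=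
    (hasDerivAt_integral_of_dominated_loc_of_deriv_le (F := fun t x => f (γ t * x))
      (F' := fun t x => f' (γ t * x)) (bound := fun _ => C) Filter.univ_mem
      (.of_forall fun t => (integrable (hf.comp (continuous_const_mul _))).aestronglyMeasurable)
      (integrable (hf.comp (continuous_const_mul _)))
      (integrable (hf'.comp (continuous_const_mul _))).aestronglyMeasurable
      (.of_forall fun x t _ => hC _ ⟨_, rfl⟩) (integrable_const C)
      (.of_forall fun x t _ => hγ x t)).2
  simp only [integral_mul_left_eq_self] at hderiv
  exact hderiv.unique (hasDerivAt_const _ _)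

lemma hasDerivAt_eval_of_derivation {σ : Type*} (D : Derivation ℂ (MvPolynomial σ ℂ)
    (MvPolynomial σ ℂ)) (c : ℂ) {z : ℝ → σ → ℂ} {t : ℝ}
    (hz : ∀ v, HasDerivAt (fun s => z s v) (c * eval (z t) (D (X v))) t)
    (p : MvPolynomial σ ℂ) :
    HasDerivAt (fun s => eval (z s) p) (c * eval (z t) (D p)) t := by
  induction p using MvPolynomial.induction_on with
  | C a => simpa using hasDerivAt_const t a
  | add p q hp hq => simpa only [map_add, mul_add] using hp.fun_add hq
  | mul_X p v hp =>
    simp only [map_mul, eval_X]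
    refine (hp.fun_mul (hz v)).congr_deriv ?_
    simp only [Derivation.leibniz, smul_eq_mul, map_add, map_mul, eval_X]
    ring

lemma derivation_prod {R A M τ : Type*} [CommSemiring R] [CommSemiring A] [AddCommMonoid M]
    [Algebra R A] [Module A M] [Module R M] [DecidableEq τ] (D : Derivation R A M) (s : Finset τ)
    (f : τ → A) : D (∏ t ∈ s, f t) = ∑ t ∈ s, (∏ t' ∈ s.erase t, f t') • D (f t) := by
  induction s using Finset.induction_on with
  | empty => simp
  | insert t s ht ih =>
    rw [Finset.prod_insert ht, D.leibniz, ih, Finset.sum_insert ht, Finset.erase_insert ht,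
      Finset.smul_sum, add_comm]
    congr 1
    refine Finset.sum_congr rfl fun t' ht' => ?_
    rw [Finset.erase_insert_of_ne (by rintro rfl; exact ht ht'), Finset.prod_insert (by simp [ht]),
      smul_smul]

lemma prod_apply_add_single {γ M : Type*} [Fintype γ] [CommMonoid M] {f a : ℕ → M}
    (hf : ∀ n, f (n + 1) = a n * f n) (s : γ →₀ ℕ) (c : γ) :
    ∏ x, f ((s + Finsupp.single c 1 : γ →₀ ℕ) x) = a (s c) * ∏ x, f (s x) := by
  classical
  rw [← Finset.mul_prod_erase _ _ (Finset.mem_univ c),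
    ← Finset.mul_prod_erase _ (fun x => f (s x)) (Finset.mem_univ c), ← mul_assoc, ← hf]
  congr 1
  · simp
  · refine Finset.prod_congr rfl fun x hx => ?_
    simp [Finsupp.single_eq_of_ne (Finset.ne_of_mem_erase hx)]

section

variable {B γ : Type*} [Fintype B]

/-- The multiplicity function `c ↦ |f⁻¹(c)|` of a map with finite domain, as the exponent of the
monomial `∏ b, X (f b)`. -/
def fiberCount (f : B → γ) : γ →₀ ℕ := ∑ b, Finsupp.single (f b) 1

lemma fiberCount_apply [DecidableEq γ] (f : B → γ) (c : γ) :
    fiberCount f c = (Finset.univ.filter fun b => f b = c).card := by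
  simp [fiberCount, Finsupp.finsetSum_apply, Finsupp.single_apply]

lemma fiberCount_comp_equiv (f : B → γ) (σ : Equiv.Perm B) :
    fiberCount (f ∘ σ) = fiberCount f :=
  Equiv.sum_comp σ fun b => Finsupp.single (f b) 1

lemma mapDomain_fst_fiberCount {δ : Type*} (r : B → γ) (a : B → δ) :
    (fiberCount fun b => (r b, a b)).mapDomain Prod.fst = fiberCount r := by
  simp [fiberCount, Finsupp.mapDomain_finsetSum]

lemma exists_perm_comp_eq {f g : B → γ} (h : fiberCount f = fiberCount g) :
    ∃ σ : Equiv.Perm B, f ∘ σ = g := by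
  have := Classical.decEq γ
  have hcard (c : γ) : Fintype.card {b // g b = c} = Fintype.card {b // f b = c} := by
    rw [Fintype.card_subtype, Fintype.card_subtype, ← fiberCount_apply, ← fiberCount_apply, h]
  exact ⟨Equiv.ofFiberEquiv fun c => Fintype.equivOfCardEq (hcard c),
    funext fun b => Equiv.ofFiberEquiv_map _ b⟩

lemma card_perm_comp_eq [DecidableEq B] [Fintype γ] [DecidableEq γ] (f g : B → γ) :
    (Finset.univ.filter fun σ : Equiv.Perm B => f ∘ σ = g).card =
      if fiberCount f = fiberCount g then ∏ c, (fiberCount g c)! else 0 := by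
  split_ifs with h
  · obtain ⟨τ, rfl⟩ := exists_perm_comp_eq h
    simp only [fiberCount_apply, ← Fintype.card_subtype, ← DomMulAct.stabilizer_card]
    refine Fintype.card_congr ((Equiv.mulLeft τ).subtypeEquiv fun σ => ?_).symm
    rw [Equiv.coe_mulLeft, Equiv.Perm.coe_mul, Function.comp_assoc]
  · refine Finset.card_eq_zero.2 (Finset.filter_eq_empty_iff.2 fun σ _ hσ => h ?_)
    rw [← hσ, fiberCount_comp_equiv]

end

/-! ### Random bras and the action of matrices on polynomials -/

instance (d : ℕ) : (haarUnitary d).IsMulLeftInvariant := by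
  unfold haarUnitary; infer_instance

instance (d : ℕ) : IsProbabilityMeasure (haarUnitary d) :=
  ⟨Measure.haarMeasure_self (K₀ := ⊤)⟩

instance (d : ℕ) : SecondCountableTopology (Matrix (Fin d) (Fin d) ℂ) :=
  inferInstanceAs (SecondCountableTopology (Fin d → Fin d → ℂ))

instance (d : ℕ) : SecondCountableTopology (Matrix.unitaryGroup (Fin d) ℂ) :=
  TopologicalSpace.Subtype.secondCountableTopology _

/-- Independent Haar random unitaries, one for each colour in `ι`. -/
def haarTuple (ι : Type*) [Fintype ι] (d : ℕ) : Measure (ι → Matrix.unitaryGroup (Fin d) ℂ) :=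
  Measure.pi fun _ => haarUnitary d

section

variable {ι : Type*} {d : ℕ}

instance [Fintype ι] : (haarTuple ι d).IsMulLeftInvariant := by
  unfold haarTuple; infer_instance

instance [Fintype ι] : IsProbabilityMeasure (haarTuple ι d) := by
  unfold haarTuple; infer_instance

lemma integrable_haarTuple [Fintype ι] {f : (ι → Matrix.unitaryGroup (Fin d) ℂ) → ℂ}
    (hf : Continuous f) : Integrable f (haarTuple ι d) :=
  hf.integrable_of_hasCompactSupport (.of_compactSpace f)

/-- The coordinates `⟨φ_i|x⟩` of the bras of the random pure states `|φ_i⟩ = U_i |0⟩`. -/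
def braCoord [NeZero d] (U : ι → Matrix.unitaryGroup (Fin d) ℂ) : ι × Fin d → ℂ :=
  fun c => star ((U c.1 : Matrix (Fin d) (Fin d) ℂ) c.2 0)

lemma continuous_braCoord [NeZero d] (c : ι × Fin d) :
    Continuous fun U : ι → Matrix.unitaryGroup (Fin d) ℂ => braCoord U c :=
  ((continuous_subtype_val.comp (continuous_apply c.1)).matrix_elem c.2 0).star

lemma continuous_eval_braCoord [NeZero d] (g : MvPolynomial (ι × Fin d) ℂ) :
    Continuous fun U : ι → Matrix.unitaryGroup (Fin d) ℂ => eval (braCoord U) g :=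
  g.continuous_eval.comp (continuous_pi continuous_braCoord)

lemma integrable_star_eval_mul_eval [Fintype ι] [NeZero d] (h g : MvPolynomial (ι × Fin d) ℂ) :
    Integrable (fun U => star (eval (braCoord U) h) * eval (braCoord U) g) (haarTuple ι d) :=
  integrable_haarTuple ((continuous_eval_braCoord h).star.mul (continuous_eval_braCoord g))

lemma sum_star_braCoord_mul_braCoord [NeZero d] (U : ι → Matrix.unitaryGroup (Fin d) ℂ) (i : ι) :
    ∑ x, star (braCoord U (i, x)) * braCoord U (i, x) = 1 := by
  have h := congrFun (congrFun (Matrix.mem_unitaryGroup_iff'.1 (U i).2) 0) 0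
  rw [Matrix.mul_apply] at h
  simpa [braCoord, Matrix.star_apply, mul_comm] using h

/-- The derivation of `ℂ[X_{i,x}]` through which `A ∈ 𝔤𝔩_d` acts on the variables of colour `i`:
it sends `X_{i,x}` to `∑_y A_{y,x} X_{i,y}` and kills the other variables. -/
def matrixDerivation (i : ι) (A : Matrix (Fin d) (Fin d) ℂ) :
    Derivation ℂ (MvPolynomial (ι × Fin d) ℂ) (MvPolynomial (ι × Fin d) ℂ) :=
  ∑ y, ∑ x, A y x • (X (i, y) : MvPolynomial (ι × Fin d) ℂ) • pderiv (i, x)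

section

variable (i : ι) (A B : Matrix (Fin d) (Fin d) ℂ) (p : MvPolynomial (ι × Fin d) ℂ)

lemma matrixDerivation_apply :
    matrixDerivation i A p = ∑ y, ∑ x, A y x • (X (i, y) * pderiv (i, x) p) := by
  change Derivation.coeFnAddMonoidHom _ p = _
  simp [matrixDerivation, map_sum]

lemma matrixDerivation_add :
    matrixDerivation i (A + B) p = matrixDerivation i A p + matrixDerivation i B p := by
  simp [matrixDerivation_apply, add_smul, Finset.sum_add_distrib]

lemma matrixDerivation_smul (c : ℂ) :
    matrixDerivation i (c • A) p = c • matrixDerivation i A p := by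
  simp [matrixDerivation_apply, mul_smul, Finset.smul_sum]

lemma matrixDerivation_single (x y : Fin d) :
    matrixDerivation i (Matrix.single y x 1) p = X (i, y) * pderiv (i, x) p := by
  rw [matrixDerivation_apply, Finset.sum_eq_single y, Finset.sum_eq_single x] <;>
    simp +contextual [Matrix.single_apply, eq_comm]

lemma matrixDerivation_X [DecidableEq ι] (j : ι) (x : Fin d) :
    matrixDerivation i A (X (j, x)) = if j = i then ∑ y, A y x • X (i, y) else 0 := by
  split_ifs with h
  · subst h
    simp [matrixDerivation_apply, pderiv_X, Pi.single_apply]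
  · simp [matrixDerivation_apply, pderiv_X, h, Prod.ext_iff]

lemma matrixDerivation_eq_sum_mul_pderiv :
    matrixDerivation i A p = ∑ x, matrixDerivation i A (X (i, x)) * pderiv (i, x) p := by
  classical
  simp only [matrixDerivation_X, if_true, Finset.sum_mul, smul_mul_assoc]
  rw [matrixDerivation_apply, Finset.sum_comm]

end

lemma matrixDerivation_matrixDerivation_X (i : ι) (A A' : Matrix (Fin d) (Fin d) ℂ)
    (c : ι × Fin d) : matrixDerivation i A (matrixDerivation i A' (X c)) =
      matrixDerivation i (A * A') (X c) := by
  classical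
  obtain ⟨j, x⟩ := c
  rw [matrixDerivation_X, matrixDerivation_X]
  split_ifs
  · simp only [map_sum, Derivation.map_smul, matrixDerivation_X, if_true, Finset.smul_sum,
      smul_smul, Matrix.mul_apply, Finset.sum_smul]
    rw [Finset.sum_comm]
    simp only [mul_comm]
  · exact map_zero _

/-- `tr A` plus the action of `A ∈ 𝔤𝔩_d` on the colour `i`: the operator which, up to the factor
`d + m`, corresponds to multiplication by `⟨φ_i| A |φ_i⟩` on polynomials of degree `m` in that
colour. -/
def traceShift (i : ι) (A : Matrix (Fin d) (Fin d) ℂ) :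
    MvPolynomial (ι × Fin d) ℂ →ₗ[ℂ] MvPolynomial (ι × Fin d) ℂ :=
  A.trace • LinearMap.id + (matrixDerivation i A : _ →ₗ[ℂ] _)

lemma traceShift_apply (i : ι) (A : Matrix (Fin d) (Fin d) ℂ) (p : MvPolynomial (ι × Fin d) ℂ) :
    traceShift i A p = A.trace • p + matrixDerivation i A p := rfl

lemma sum_pderiv_matrixDerivation_X_mul (i : ι) (A : Matrix (Fin d) (Fin d) ℂ)
    (p : MvPolynomial (ι × Fin d) ℂ) :
    ∑ x, pderiv (i, x) (matrixDerivation i A (X (i, x)) * p) = traceShift i A p := by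
  classical
  have htrace : ∑ x, pderiv (i, x) (matrixDerivation i A (X (i, x))) = C A.trace := by
    simp [matrixDerivation_X, pderiv_X, Pi.single_apply, Matrix.trace, smul_eq_C_mul]
  rw [traceShift_apply, matrixDerivation_eq_sum_mul_pderiv i A p, smul_eq_C_mul, ← htrace]
  simp only [Derivation.leibniz, smul_eq_mul, Finset.sum_add_distrib, Finset.sum_mul]
  rw [add_comm]
  simp only [mul_comm p]

open scoped Matrix.Norms.L2Operator in
lemma exists_unitary_hasDerivAt {H : Matrix (Fin d) (Fin d) ℂ} (hH : H.IsHermitian) :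
    ∃ γ : ℝ → Matrix.unitaryGroup (Fin d) ℂ, ∀ t x y,
      HasDerivAt (fun s => (γ s : Matrix (Fin d) (Fin d) ℂ) x y)
        (((Complex.I • H) * (γ t : Matrix (Fin d) (Fin d) ℂ)) x y) t := by
  refine ⟨fun t => selfAdjoint.expUnitary (t • ⟨H, hH⟩), fun t x y => ?_⟩
  have hexp (s : ℝ) : (selfAdjoint.expUnitary (s • (⟨H, hH⟩ : selfAdjoint _)) :
      Matrix (Fin d) (Fin d) ℂ) = NormedSpace.exp (s • Complex.I • H) := by
    rw [selfAdjoint.expUnitary_coe, selfAdjoint.val_smul, smul_comm]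
  simp only [hexp]
  exact (Matrix.entryLinearMap ℝ ℂ x y).toContinuousLinearMap.hasFDerivAt.comp_hasDerivAt t
    (hasDerivAt_exp_smul_const' (Complex.I • H) t)

variable [DecidableEq ι]

lemma traceShift_matrixDerivation_X_mul (A : Matrix (Fin d) (Fin d) ℂ) (i j : ι) (x : Fin d)
    (g : MvPolynomial (ι × Fin d) ℂ) :
    traceShift i A (matrixDerivation j A (X (j, x)) * g) =
      matrixDerivation j A (X (j, x)) * traceShift i A g +
        if j = i then matrixDerivation j (A * A) (X (j, x)) * g else 0 := by
  split_ifs with hij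
  · subst hij
    simp only [traceShift_apply, Derivation.leibniz, matrixDerivation_matrixDerivation_X,
      smul_eq_mul]
    rw [mul_add, mul_smul_comm]
    ring
  · have : matrixDerivation i A (matrixDerivation j A (X (j, x))) = 0 := by
      simp [matrixDerivation_X, hij]
    simp only [traceShift_apply, Derivation.leibniz, this, smul_eq_mul, mul_add, mul_smul_comm,
      mul_zero, add_zero]

lemma hasDerivAt_braCoord_mulSingle_mul [NeZero d] (i : ι) {H : Matrix (Fin d) (Fin d) ℂ}
    (hH : H.IsHermitian) {γ : ℝ → Matrix.unitaryGroup (Fin d) ℂ} {t : ℝ}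
    (hγ : ∀ x y, HasDerivAt (fun s => (γ s : Matrix (Fin d) (Fin d) ℂ) x y)
      (((Complex.I • H) * (γ t : Matrix (Fin d) (Fin d) ℂ)) x y) t)
    (U : ι → Matrix.unitaryGroup (Fin d) ℂ) (c : ι × Fin d) :
    HasDerivAt (fun s => braCoord (Pi.mulSingle i (γ s) * U) c)
      (-Complex.I * eval (braCoord (Pi.mulSingle i (γ t) * U)) (matrixDerivation i H (X c)))
      t := by
  obtain ⟨j, x⟩ := c
  rw [matrixDerivation_X]
  split_ifs with h
  · subst h
    have hcoord (s : ℝ) (y : Fin d) : braCoord (Pi.mulSingle j (γ s) * U) (j, y) =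
        star (∑ z, (γ s : Matrix (Fin d) (Fin d) ℂ) y z *
          (U j : Matrix (Fin d) (Fin d) ℂ) z 0) := by
      simp [braCoord, Matrix.mul_apply]
    simp only [hcoord]
    refine (HasDerivAt.fun_sum fun z _ => (hγ x z).mul_const _).star.congr_deriv ?_
    simp only [← Matrix.mul_apply, Matrix.mul_assoc]
    simp [Matrix.mul_apply, Finset.mul_sum, hcoord, ← hH.apply x, mul_assoc]
  · simpa [braCoord, Pi.mulSingle_eq_of_ne h] using hasDerivAt_const t _

/-- The weight on the variables whose weighted degree counts the variables of colour `i`. -/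
def colorWeight (i : ι) : ι × Fin d → ℕ := fun c => if c.1 = i then 1 else 0

lemma isWeightedHomogeneous_colorWeight_monomial (i : ι) (s : ι × Fin d →₀ ℕ) (c : ℂ) :
    (monomial s c).IsWeightedHomogeneous (colorWeight i) (s.mapDomain Prod.fst i) := by
  refine isWeightedHomogeneous_monomial _ _ _ ?_
  induction s using Finsupp.induction_linear with
  | zero => simp
  | add s t hs ht => rw [map_add, Finsupp.mapDomain_add, Finsupp.add_apply, hs, ht]
  | single c n => simp [Finsupp.weight_single, colorWeight, Finsupp.single_apply]

lemma sum_pderiv_X_mul [Finite ι] {i : ι} {m : ℕ} {h : MvPolynomial (ι × Fin d) ℂ}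
    (hh : h.IsWeightedHomogeneous (colorWeight i) m) :
    ∑ y, pderiv (i, y) (X (i, y) * h) = ((d : ℂ) + m) • h := by
  have := Fintype.ofFinite ι
  have heuler : ∑ y, X (i, y) * pderiv (i, y) h = (m : ℂ) • h := by
    simpa [colorWeight, Fintype.sum_prod_type_right, Nat.cast_smul_eq_nsmul] using
      hh.sum_weight_X_mul_pderiv
  simp only [Derivation.leibniz, pderiv_X_self, smul_eq_mul, mul_one, Finset.sum_add_distrib,
    heuler, Finset.sum_const, Finset.card_univ, Fintype.card_fin]
  module

end

/-! ### The inner product on polynomials -/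

section

variable {ι : Type*} {d : ℕ} [Fintype ι] [NeZero d]

/-- The inner product of polynomials on the product of unit spheres: `⟨h, g⟩` is the expectation of
`conj (h z) * g z`, where `z` collects the coordinates of the random bras `⟨φ_i|`. -/
def haarInner : MvPolynomial (ι × Fin d) ℂ →ₗ⋆[ℂ] MvPolynomial (ι × Fin d) ℂ →ₗ[ℂ] ℂ :=
  LinearMap.mk₂'ₛₗ (starRingEnd ℂ) (RingHom.id ℂ)
    (fun h g => ∫ U, star (eval (braCoord U) h) * eval (braCoord U) g ∂haarTuple ι d)
    (fun h₁ h₂ g => by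
      simp only [map_add, star_add, add_mul]
      exact integral_add (integrable_star_eval_mul_eval _ _) (integrable_star_eval_mul_eval _ _))
    (fun c h g => by simp [mul_assoc, integral_const_mul])
    (fun h g₁ g₂ => by
      simp only [map_add, mul_add]
      exact integral_add (integrable_star_eval_mul_eval _ _) (integrable_star_eval_mul_eval _ _))
    (fun c h g => by simp [mul_left_comm, integral_const_mul])

lemma haarInner_apply (h g : MvPolynomial (ι × Fin d) ℂ) :
    haarInner h g = ∫ U, star (eval (braCoord U) h) * eval (braCoord U) g ∂haarTuple ι d := rfl

lemma star_haarInner (h g : MvPolynomial (ι × Fin d) ℂ) :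
    star (haarInner h g) = haarInner g h := by
  rw [haarInner_apply, haarInner_apply, Complex.star_def, ← integral_conj]
  simp [mul_comm]

lemma haarInner_one_one : haarInner (1 : MvPolynomial (ι × Fin d) ℂ) 1 = 1 := by
  simp [haarInner_apply]

lemma sum_haarInner_X_mul (i : ι) (h g : MvPolynomial (ι × Fin d) ℂ) :
    ∑ x, haarInner (X (i, x) * h) (X (i, x) * g) = haarInner h g := by
  simp only [haarInner_apply]
  rw [← integral_finsetSum _ fun x _ => integrable_star_eval_mul_eval _ _]
  refine integral_congr_ae (.of_forall fun U => ?_)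
  simp only [map_mul, eval_X, star_mul', mul_mul_mul_comm, ← Finset.sum_mul,
    sum_star_braCoord_mul_braCoord, one_mul]

lemma haarInner_matrixDerivation_of_isHermitian (i : ι) {H : Matrix (Fin d) (Fin d) ℂ}
    (hH : H.IsHermitian) (h g : MvPolynomial (ι × Fin d) ℂ) :
    haarInner (matrixDerivation i H h) g = haarInner h (matrixDerivation i H g) := by
  classical
  obtain ⟨γ, hγ⟩ := exists_unitary_hasDerivAt hH
  have hderiv (p : MvPolynomial (ι × Fin d) ℂ) (U : ι → Matrix.unitaryGroup (Fin d) ℂ) (t : ℝ) :=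
    hasDerivAt_eval_of_derivation (matrixDerivation i H) _
      (hasDerivAt_braCoord_mulSingle_mul i hH (hγ t) U) p
  have hcont (p q : MvPolynomial (ι × Fin d) ℂ) :
      Continuous fun U => star (eval (braCoord U) p) * eval (braCoord U) q :=
    (continuous_eval_braCoord p).star.mul (continuous_eval_braCoord q)
  have hzero := integral_eq_zero_of_hasDerivAt_mul_left (μ := haarTuple ι d) (hcont h g)
    (((hcont (matrixDerivation i H h) g).fun_sub (hcont h (matrixDerivation i H g))).const_mul
      Complex.I)
    (fun t => Pi.mulSingle i (γ t)) fun U t =>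
      ((hderiv h U t).star.fun_mul (hderiv g U t)).congr_deriv (by
        simp only [star_mul', star_neg, Complex.star_def, Complex.conj_I]
        ring)
  rw [integral_const_mul, integral_sub (integrable_star_eval_mul_eval _ _)
    (integrable_star_eval_mul_eval _ _)] at hzero
  exact sub_eq_zero.1 ((mul_eq_zero.1 hzero).resolve_left Complex.I_ne_zero)

lemma haarInner_matrixDerivation_conjTranspose (i : ι) (A : Matrix (Fin d) (Fin d) ℂ)
    (h g : MvPolynomial (ι × Fin d) ℂ) :
    haarInner (matrixDerivation i A.conjTranspose h) g = haarInner h (matrixDerivation i A g) := by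
  set R : Matrix (Fin d) (Fin d) ℂ := (realPart A).1
  set J : Matrix (Fin d) (Fin d) ℂ := (imaginaryPart A).1
  have hR : R.IsHermitian := (realPart A).2
  have hJ : J.IsHermitian := (imaginaryPart A).2
  have hA : A = R + Complex.I • J := (realPart_add_I_smul_imaginaryPart A).symm
  rw [hA, Matrix.conjTranspose_add, Matrix.conjTranspose_smul, hR.eq, hJ.eq]
  simp only [matrixDerivation_add, matrixDerivation_smul, map_add, map_smul, map_smulₛₗ,
    LinearMap.add_apply, LinearMap.smul_apply, haarInner_matrixDerivation_of_isHermitian i hR,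
    haarInner_matrixDerivation_of_isHermitian i hJ]
  simp

lemma haarInner_pderiv [DecidableEq ι] {i : ι} {m : ℕ} {h : MvPolynomial (ι × Fin d) ℂ}
    (hh : h.IsWeightedHomogeneous (colorWeight i) m) (x : Fin d)
    (g : MvPolynomial (ι × Fin d) ℂ) :
    haarInner h (pderiv (i, x) g) = (d + m) * haarInner (X (i, x) * h) g := by
  have htranspose (y : Fin d) : haarInner (X (i, y) * h) (X (i, y) * pderiv (i, x) g) =
      haarInner (X (i, x) * pderiv (i, y) (X (i, y) * h)) g := by
    rw [← matrixDerivation_single, ← matrixDerivation_single,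
      ← haarInner_matrixDerivation_conjTranspose, Matrix.conjTranspose_single, star_one]
  calc haarInner h (pderiv (i, x) g)
      = ∑ y, haarInner (X (i, y) * h) (X (i, y) * pderiv (i, x) g) :=
        (sum_haarInner_X_mul i h _).symm
    _ = haarInner (X (i, x) * ∑ y, pderiv (i, y) (X (i, y) * h)) g := by
        simp only [htranspose, Finset.mul_sum, map_sum, LinearMap.sum_apply]
    _ = (d + m) * haarInner (X (i, x) * h) g := by
        rw [sum_pderiv_X_mul hh, mul_smul_comm, map_smulₛₗ]
        simp

lemma haarInner_monomial {s : ι × Fin d →₀ ℕ} {g : MvPolynomial (ι × Fin d) ℂ}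
    (hg : g.IsHomogeneous s.degree) :
    (∏ i, d.ascFactorial (s.mapDomain Prod.fst i) : ℕ) * haarInner (monomial s 1) g =
      (∏ c, (s c)! : ℕ) * coeff s g := by
  classical
  obtain ⟨t, rfl⟩ := Multiset.toFinsupp.surjective s
  induction t using Multiset.induction generalizing g with
  | empty =>
    rw [map_zero, map_zero, ← totalDegree_zero_iff_isHomogeneous,
      totalDegree_eq_zero_iff_eq_C] at hg
    rw [hg, ← mul_one (C _), C_mul', map_smul]
    simp [haarInner_one_one]
  | cons c t ih =>
    rw [← Multiset.singleton_add, add_comm, map_add, Multiset.toFinsupp_singleton] at hg ⊢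
    generalize Multiset.toFinsupp t = s at *
    have hpderiv := ih (g := pderiv c g) (by simpa using hg.pderiv)
    rw [coeff_pderiv,
      haarInner_pderiv (isWeightedHomogeneous_colorWeight_monomial c.1 s 1)] at hpderiv
    rw [Finsupp.mapDomain_add, Finsupp.mapDomain_single,
      prod_apply_add_single fun n => Nat.ascFactorial_succ,
      prod_apply_add_single Nat.factorial_succ, monomial_add_single, pow_one, mul_comm _ (X c)]
    push_cast at hpderiv ⊢
    linear_combination hpderiv

end

/-! ### Tensors as polynomials -/

lemma symDim_mul_factorial (d m : ℕ) [NeZero d] : symDim d m * m ! = d.ascFactorial m := by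
  obtain ⟨e, rfl⟩ := Nat.exists_eq_succ_of_ne_zero (NeZero.ne d)
  rw [Nat.ascFactorial_eq_factorial_mul_choose, ← Nat.choose_symm_add, mul_comm, add_comm e m]
  rfl

section

variable {ι : Type*} {d : ℕ} {B : Type} [Fintype B]

/-- Invariance of a vector under all permutations of the qudits that preserve the colouring `r`. -/
def IsColorSymm (r : B → ι) (v : QuditSpace B d) : Prop :=
  ∀ σ : Equiv.Perm B, r ∘ σ = r → ∀ a, v (a ∘ σ) = v a

variable [DecidableEq B]

/-- The polynomial whose value at the bras `⟨φ_i|` is `⟨⨂_b φ_{r b} | v⟩`, where the qudit `b` has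
colour `r b`. -/
def tensorPoly (r : B → ι) : QuditSpace B d →ₗ[ℂ] MvPolynomial (ι × Fin d) ℂ :=
  ∑ a, monomial (fiberCount fun b => (r b, a b)) ∘ₗ LinearMap.proj a

section

variable (r : B → ι) (v : QuditSpace B d)

lemma tensorPoly_apply :
    tensorPoly r v = ∑ a, monomial (fiberCount fun b => (r b, a b)) (v a) := by
  simp [tensorPoly]

lemma eval_tensorPoly (z : ι × Fin d → ℂ) :
    eval z (tensorPoly r v) = ∑ a, v a * ∏ b, z (r b, a b) := by
  simp [tensorPoly_apply, fiberCount, monomial_sum_index, ← X.eq_1]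

lemma isWeightedHomogeneous_tensorPoly [DecidableEq ι] (i : ι) :
    (tensorPoly r v).IsWeightedHomogeneous (colorWeight i) (fiberCount r i) := by
  rw [tensorPoly_apply]
  refine IsWeightedHomogeneous.sum _ _ _ fun a _ => ?_
  rw [← mapDomain_fst_fiberCount r a]
  exact isWeightedHomogeneous_colorWeight_monomial i _ _

lemma isHomogeneous_tensorPoly (a : B → Fin d) :
    (tensorPoly r v).IsHomogeneous (fiberCount fun b => (r b, a b)).degree := by
  rw [tensorPoly_apply]
  refine IsHomogeneous.sum _ _ _ fun a' _ => isHomogeneous_monomial _ ?_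
  simp [fiberCount]

end

variable [Fintype ι] {r : B → ι} {v : QuditSpace B d}

lemma prod_factorial_mul_coeff_tensorPoly (hv : IsColorSymm r v) (a : B → Fin d) :
    (∏ c, (fiberCount (fun b => (r b, a b)) c)! : ℕ) *
        coeff (fiberCount fun b => (r b, a b)) (tensorPoly r v) =
      (∏ i, (fiberCount r i)! : ℕ) * v a := by
  classical
  calc ((∏ c, (fiberCount (fun b => (r b, a b)) c)! : ℕ) : ℂ) *
        coeff (fiberCount fun b => (r b, a b)) (tensorPoly r v)
      = ∑ a', ((Finset.univ.filter fun σ : Equiv.Perm B =>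
          (fun b => (r b, a' b)) ∘ σ = fun b => (r b, a b)).card : ℂ) * v a' := by
        simp only [tensorPoly_apply, coeff_sum, coeff_monomial, Finset.mul_sum, card_perm_comp_eq]
        simp
    _ = ∑ σ : Equiv.Perm B, ∑ a', if r ∘ σ = r then if a' ∘ σ = a then v a' else 0 else 0 := by
        rw [Finset.sum_comm]
        simp [funext_iff, Finset.card_filter, Finset.sum_mul, forall_and, ite_and]
    _ = ∑ σ : Equiv.Perm B, if r ∘ σ = r then v a else 0 := by
        refine Finset.sum_congr rfl fun σ _ => ?_
        split_ifs with hσ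
        · have hterm (a' : B → Fin d) : (if a' ∘ σ = a then v a' else 0) =
              if a' = a ∘ σ.symm then v a else 0 := by
            simp only [Equiv.eq_comp_symm]
            split_ifs with h
            · rw [← h, hv σ hσ]
            · rfl
          simp [hterm]
        · exact Finset.sum_const_zero
    _ = (∏ i, (fiberCount r i)! : ℕ) * v a := by
        rw [← Finset.sum_filter, Finset.sum_const, card_perm_comp_eq, if_pos rfl, nsmul_eq_mul]

variable [NeZero d]

lemma prod_symDim_mul_haarInner_monomial_tensorPoly (hv : IsColorSymm r v) (a : B → Fin d) :
    (∏ i, symDim d (fiberCount r i) : ℕ) *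
        haarInner (monomial (fiberCount fun b => (r b, a b)) 1) (tensorPoly r v) = v a := by
  classical
  have hwick := haarInner_monomial (isHomogeneous_tensorPoly r v a)
  rw [prod_factorial_mul_coeff_tensorPoly hv, mapDomain_fst_fiberCount] at hwick
  simp only [← symDim_mul_factorial, Finset.prod_mul_distrib] at hwick
  refine mul_left_cancel₀ (Nat.cast_ne_zero.2 (Finset.prod_ne_zero_iff.2 fun i _ =>
    (fiberCount r i).factorial_ne_zero)) (Eq.trans ?_ hwick)
  push_cast
  ring

lemma prod_symDim_mul_haarInner_tensorPoly (hv : IsColorSymm r v) (w : QuditSpace B d) :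
    (∏ i, symDim d (fiberCount r i) : ℕ) * haarInner (tensorPoly r v) (tensorPoly r w) =
      star v ⬝ᵥ w := by
  rw [← star_haarInner, ← Complex.conj_natCast, ← Complex.star_def, ← star_mul',
    tensorPoly_apply r w]
  simp only [map_sum, LinearMap.sum_apply, Finset.mul_sum, dotProduct, star_sum]
  refine Finset.sum_congr rfl fun a _ => ?_
  rw [← mul_one (w a), ← smul_eq_mul (w a), ← smul_monomial, map_smulₛₗ, LinearMap.smul_apply,
    smul_eq_mul, mul_left_comm, prod_symDim_mul_haarInner_monomial_tensorPoly hv]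
  simp [mul_comm]

end

/-! ### Moments of expectation values -/

section

variable {ι : Type*} {d : ℕ} [NeZero d]

/-- The expectation value `⟨φ_i| A |φ_i⟩` in the random pure state `|φ_i⟩ = U_i |0⟩`. -/
def stateExpectation (A : Matrix (Fin d) (Fin d) ℂ) (i : ι)
    (U : ι → Matrix.unitaryGroup (Fin d) ℂ) : ℂ :=
  (fun x => braCoord U (i, x)) ⬝ᵥ A.mulVec fun x => star (braCoord U (i, x))

lemma continuous_stateExpectation (A : Matrix (Fin d) (Fin d) ℂ) (i : ι) :
    Continuous (stateExpectation A i) :=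
  (continuous_pi fun x => continuous_braCoord (i, x)).dotProduct
    (continuous_const.matrix_mulVec (continuous_pi fun x => (continuous_braCoord (i, x)).star))

lemma ofReal_re_stateExpectation (hA : A.IsHermitian) (i : ι)
    (U : ι → Matrix.unitaryGroup (Fin d) ℂ) :
    ((stateExpectation A i U).re : ℂ) = stateExpectation A i U := by
  refine Complex.ext rfl ?_
  have him := hA.im_star_dotProduct_mulVec_self fun x => star (braCoord U (i, x))
  simp only [Pi.star_def, star_star] at him
  exact him.symm

lemma stateExpectation_eq_sum (A : Matrix (Fin d) (Fin d) ℂ) (i : ι)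
    (U : ι → Matrix.unitaryGroup (Fin d) ℂ) : stateExpectation A i U =
      ∑ x, star (braCoord U (i, x)) * eval (braCoord U) (matrixDerivation i A (X (i, x))) := by
  classical
  simp only [matrixDerivation_X, if_true, map_sum, smul_eval, eval_X, stateExpectation,
    dotProduct, Matrix.mulVec, Finset.mul_sum]
  rw [Finset.sum_comm]
  refine Finset.sum_congr rfl fun x _ => Finset.sum_congr rfl fun y _ => by ring

variable [Fintype ι]

lemma integral_stateExpectation_mul (A : Matrix (Fin d) (Fin d) ℂ) (i : ι)
    (h g : MvPolynomial (ι × Fin d) ℂ) :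
    ∫ U, stateExpectation A i U * (star (eval (braCoord U) h) * eval (braCoord U) g)
        ∂haarTuple ι d =
      ∑ x, haarInner (X (i, x) * h) (matrixDerivation i A (X (i, x)) * g) := by
  simp only [haarInner_apply]
  rw [← integral_finsetSum _ fun x _ => integrable_star_eval_mul_eval _ _]
  refine integral_congr_ae (.of_forall fun U => ?_)
  simp only [stateExpectation_eq_sum, Finset.sum_mul, map_mul, star_mul', eval_X]
  exact Finset.sum_congr rfl fun x _ => by ring

variable [DecidableEq ι]

lemma sum_haarInner_X_mul_matrixDerivation (A : Matrix (Fin d) (Fin d) ℂ) {i : ι} {m : ℕ}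
    {h : MvPolynomial (ι × Fin d) ℂ} (hh : h.IsWeightedHomogeneous (colorWeight i) m)
    (g : MvPolynomial (ι × Fin d) ℂ) :
    (d + m) * ∑ x, haarInner (X (i, x) * h) (matrixDerivation i A (X (i, x)) * g) =
      haarInner h (traceShift i A g) := by
  rw [← sum_pderiv_matrixDerivation_X_mul, map_sum, Finset.mul_sum]
  exact Finset.sum_congr rfl fun x _ => (haarInner_pderiv hh x _).symm

lemma integral_stateExpectation (A : Matrix (Fin d) (Fin d) ℂ) {i : ι} {m : ℕ}
    {h : MvPolynomial (ι × Fin d) ℂ} (hh : h.IsWeightedHomogeneous (colorWeight i) m)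
    (g : MvPolynomial (ι × Fin d) ℂ) :
    (d + m) * ∫ U, stateExpectation A i U * (star (eval (braCoord U) h) * eval (braCoord U) g)
        ∂haarTuple ι d = haarInner h (traceShift i A g) := by
  rw [integral_stateExpectation_mul, sum_haarInner_X_mul_matrixDerivation A hh]

lemma integral_stateExpectation_mul_stateExpectation (A : Matrix (Fin d) (Fin d) ℂ) {i j : ι}
    {m n : ℕ} {h : MvPolynomial (ι × Fin d) ℂ} (hi : h.IsWeightedHomogeneous (colorWeight i) m)
    (hj : h.IsWeightedHomogeneous (colorWeight j) n) (g : MvPolynomial (ι × Fin d) ℂ) :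
    (d + n) * ((d + m + if j = i then 1 else 0) *
        ∫ U, stateExpectation A i U * stateExpectation A j U *
          (star (eval (braCoord U) h) * eval (braCoord U) g) ∂haarTuple ι d) =
      haarInner h (traceShift j A (traceShift i A g)) +
        if j = i then haarInner h (traceShift j (A * A) g) else 0 := by
  have hweight (x : Fin d) : (X (j, x) * h).IsWeightedHomogeneous (colorWeight i)
      ((if j = i then 1 else 0) + m) := (isWeightedHomogeneous_X ℂ (colorWeight i) (j, x)).mul hi
  have hsplit (U : ι → Matrix.unitaryGroup (Fin d) ℂ) :
      stateExpectation A i U * stateExpectation A j U *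
          (star (eval (braCoord U) h) * eval (braCoord U) g) =
        ∑ x, stateExpectation A i U * (star (eval (braCoord U) (X (j, x) * h)) *
          eval (braCoord U) (matrixDerivation j A (X (j, x)) * g)) := by
    simp only [stateExpectation_eq_sum A j, Finset.sum_mul, Finset.mul_sum, map_mul, star_mul',
      eval_X]
    exact Finset.sum_congr rfl fun x _ => by ring
  have hint (x : Fin d) : Integrable (fun U => stateExpectation A i U *
      (star (eval (braCoord U) (X (j, x) * h)) *
        eval (braCoord U) (matrixDerivation j A (X (j, x)) * g))) (haarTuple ι d) :=
    integrable_haarTuple ((continuous_stateExpectation A i).mul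
      ((continuous_eval_braCoord _).star.mul (continuous_eval_braCoord _)))
  have hfirst (x : Fin d) :=
    integral_stateExpectation A (hweight x) (matrixDerivation j A (X (j, x)) * g)
  simp only [hsplit]
  rw [integral_finsetSum _ fun x _ => hint x, Finset.mul_sum]
  push_cast at hfirst
  simp only [← add_assoc, add_right_comm _ _ (m : ℂ)] at hfirst
  simp only [hfirst, traceShift_matrixDerivation_X_mul, map_add, Finset.sum_add_distrib, mul_add]
  rw [sum_haarInner_X_mul_matrixDerivation A hj]
  split_ifs
  · rw [sum_haarInner_X_mul_matrixDerivation (A * A) hj]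
  · simp

end

/-! ### One-body operators -/

section

variable {n : Type*} [Fintype n]

lemma norm_star_dotProduct_le {n : Type*} [Fintype n] (v w : n → ℂ) :
    ‖star v ⬝ᵥ w‖ ≤ ‖WithLp.toLp 2 v‖ * ‖WithLp.toLp 2 w‖ := by
  rw [dotProduct_comm, ← EuclideanSpace.inner_toLp_toLp]
  exact norm_inner_le_norm _ _

lemma ofReal_sum_norm_sq {n : Type*} [Fintype n] (v : n → ℂ) :
    ((∑ a, ‖v a‖ ^ 2 : ℝ) : ℂ) = star v ⬝ᵥ v := by
  simp only [dotProduct, Pi.star_apply, Complex.star_def, Complex.conj_mul', Complex.ofReal_sum,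
    Complex.ofReal_pow]

lemma norm_toLp_eq_one {n : Type*} [Fintype n] {v : n → ℂ} (hv : star v ⬝ᵥ v = 1) :
    ‖WithLp.toLp 2 v‖ = 1 := by
  rw [← ofReal_sum_norm_sq, Complex.ofReal_eq_one] at hv
  rw [EuclideanSpace.norm_eq, hv, Real.sqrt_one]

end

section

variable {ι : Type*} {d : ℕ} {B : Type} [Fintype B]

lemma tensorOp_one : tensorOp (1 : B → Matrix (Fin d) (Fin d) ℂ) = 1 := by
  ext a a'
  simp [tensorOp, Matrix.one_apply, Finset.prod_ite_zero, funext_iff]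

lemma conjTranspose_tensorOp (M : B → Matrix (Fin d) (Fin d) ℂ) :
    (tensorOp M).conjTranspose = tensorOp fun b => (M b).conjTranspose := by
  ext a a'
  simp [tensorOp]

variable [DecidableEq B]

lemma tensorOp_mul (M N : B → Matrix (Fin d) (Fin d) ℂ) :
    tensorOp M * tensorOp N = tensorOp (M * N) := by
  ext a a'
  simp only [Matrix.mul_apply, Pi.mul_apply, tensorOp, Matrix.of_apply, Finset.prod_univ_sum,
    Fintype.piFinset_univ, Finset.prod_mul_distrib]

lemma tensorOp_mulSingle_apply (p : B) (A : Matrix (Fin d) (Fin d) ℂ) (a a' : B → Fin d) :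
    tensorOp (Pi.mulSingle p A) a a' =
      A (a p) (a' p) * ∏ b ∈ Finset.univ.erase p, (1 : Matrix (Fin d) (Fin d) ℂ) (a b) (a' b) := by
  rw [tensorOp, Matrix.of_apply, ← Finset.mul_prod_erase _ _ (Finset.mem_univ p),
    Pi.mulSingle_eq_same]
  congr 1
  refine Finset.prod_congr rfl fun b hb => ?_
  rw [Pi.mulSingle_eq_of_ne (Finset.ne_of_mem_erase hb)]

/-- The one-qudit operator `A` acting on the qudit `p`, as a map from one-qudit operators to
operators on all qudits. -/
def siteHom (p : B) : Matrix (Fin d) (Fin d) ℂ →⋆ₐ[ℂ] QuditOp B d where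
  toFun A := tensorOp (Pi.mulSingle p A)
  map_one' := by rw [Pi.mulSingle_one, tensorOp_one]
  map_mul' A A' := by rw [tensorOp_mul, ← Pi.mulSingle_mul]
  map_zero' := by
    ext a a'
    simp [tensorOp_mulSingle_apply]
  map_add' A A' := by
    ext a a'
    simp [tensorOp_mulSingle_apply, add_mul]
  commutes' c := by
    calc tensorOp (Pi.mulSingle p (algebraMap ℂ (Matrix (Fin d) (Fin d) ℂ) c))
        = c • tensorOp (Pi.mulSingle p 1) := by
          ext a a'
          simp [-Pi.mulSingle_one, tensorOp_mulSingle_apply, Algebra.algebraMap_eq_smul_one,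
            mul_assoc]
      _ = algebraMap ℂ (QuditOp B d) c := by
          rw [Pi.mulSingle_one, tensorOp_one, Algebra.algebraMap_eq_smul_one]
  map_star' A := by
    rw [Matrix.star_eq_conjTranspose (tensorOp _), conjTranspose_tensorOp, ← Pi.star_mulSingle]
    rfl

lemma siteHom_apply (p : B) (A : Matrix (Fin d) (Fin d) ℂ) :
    siteHom p A = tensorOp (Pi.mulSingle p A) := rfl

/-- The one-body operator `∑_p A_p`, where `A_p` is the one-qudit operator `A` on the qudit `p`. -/
def totalOp (B : Type) [Fintype B] [DecidableEq B] (A : Matrix (Fin d) (Fin d) ℂ) : QuditOp B d :=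
  ∑ p, siteHom p A

open scoped Matrix.Norms.L2Operator in
lemma norm_totalOp_mulVec_le (A : Matrix (Fin d) (Fin d) ℂ) (v : QuditSpace B d) :
    ‖WithLp.toLp 2 ((totalOp B A).mulVec v)‖ ≤
      Fintype.card B * specNorm A * ‖WithLp.toLp 2 v‖ := by
  have hnorm : ‖totalOp B A‖ ≤ Fintype.card B * specNorm A := by
    refine (norm_sum_le_of_le _ fun p _ =>
      NonUnitalStarAlgHom.norm_apply_le (siteHom (B := B) p) A).trans ?_
    rw [Finset.sum_const, Finset.card_univ, nsmul_eq_mul, Matrix.cstar_norm_def, specNorm]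
  exact (Matrix.l2_opNorm_mulVec _ (WithLp.toLp 2 v)).trans (by gcongr)

lemma re_star_dotProduct_totalOp_mulVec_le (A : Matrix (Fin d) (Fin d) ℂ)
    (hunit : star v ⬝ᵥ v = 1) :
    (star v ⬝ᵥ (totalOp B A).mulVec v).re ≤ Fintype.card B * specNorm A :=
  calc (star v ⬝ᵥ (totalOp B A).mulVec v).re
      ≤ ‖WithLp.toLp 2 v‖ * ‖WithLp.toLp 2 ((totalOp B A).mulVec v)‖ :=
        (Complex.re_le_norm _).trans (norm_star_dotProduct_le _ _)
    _ ≤ Fintype.card B * specNorm A := by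
        simpa [norm_toLp_eq_one hunit] using norm_totalOp_mulVec_le A v

lemma re_star_dotProduct_totalOp_mulVec_mulVec_le (A : Matrix (Fin d) (Fin d) ℂ)
    (hunit : star v ⬝ᵥ v = 1) :
    (star v ⬝ᵥ (totalOp B A).mulVec ((totalOp B A).mulVec v)).re ≤
      (Fintype.card B) ^ 2 * specNorm A ^ 2 :=
  have hnorm := norm_toLp_eq_one hunit
  calc (star v ⬝ᵥ (totalOp B A).mulVec ((totalOp B A).mulVec v)).re
      ≤ ‖WithLp.toLp 2 v‖ * ‖WithLp.toLp 2 ((totalOp B A).mulVec ((totalOp B A).mulVec v))‖ :=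
        (Complex.re_le_norm _).trans (norm_star_dotProduct_le _ _)
    _ ≤ Fintype.card B * specNorm A * (Fintype.card B * specNorm A * ‖WithLp.toLp 2 v‖) := by
        rw [hnorm, one_mul, ← hnorm]
        refine (norm_totalOp_mulVec_le A _).trans ?_
        gcongr
        · exact mul_nonneg (Nat.cast_nonneg _) (norm_nonneg _)
        · exact norm_totalOp_mulVec_le A v
    _ = (Fintype.card B) ^ 2 * specNorm A ^ 2 := by rw [hnorm]; ring

lemma tensorPoly_eq_sum_smul_prod (r : B → ι) (v : QuditSpace B d) :
    tensorPoly r v = ∑ a, v a • ∏ b, X (r b, a b) := by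
  simp [tensorPoly_apply, fiberCount, monomial_sum_index, smul_eq_C_mul, ← X.eq_1]

lemma tensorPoly_tensorOp_mulVec (r : B → ι) (M : B → Matrix (Fin d) (Fin d) ℂ)
    (v : QuditSpace B d) : tensorPoly r ((tensorOp M).mulVec v) =
      ∑ a, v a • ∏ b, ∑ x, M b x (a b) • X (r b, x) := by
  simp only [tensorPoly_eq_sum_smul_prod, Matrix.mulVec, dotProduct, tensorOp, Matrix.of_apply,
    Finset.prod_univ_sum, Fintype.piFinset_univ, Finset.smul_sum, Finset.sum_smul]
  rw [Finset.sum_comm]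
  simp only [Finset.prod_smul, smul_smul, mul_comm]

lemma tensorPoly_totalOp_mulVec [Fintype ι] (r : B → ι)
    (A : Matrix (Fin d) (Fin d) ℂ) (v : QuditSpace B d) :
    tensorPoly r ((totalOp B A).mulVec v) = ∑ i, matrixDerivation i A (tensorPoly r v) := by
  classical
  have hsite (a : B → Fin d) (p : B) :
      ∏ b, ∑ x, (Pi.mulSingle p A : B → Matrix (Fin d) (Fin d) ℂ) b x (a b) • X (r b, x) =
        ∑ i : ι, (∏ b ∈ Finset.univ.erase p, (X (r b, a b) : MvPolynomial (ι × Fin d) ℂ)) •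
          matrixDerivation i A (X (r p, a p)) := by
    have hother (b : B) (hb : b ∈ Finset.univ.erase p) :
        ∑ x, (Pi.mulSingle p A : B → Matrix (Fin d) (Fin d) ℂ) b x (a b) • X (r b, x) =
          (X (r b, a b) : MvPolynomial (ι × Fin d) ℂ) := by
      rw [Pi.mulSingle_eq_of_ne (Finset.ne_of_mem_erase hb)]
      simp [Matrix.one_apply]
    rw [← Finset.prod_erase_mul _ _ (Finset.mem_univ p), Finset.prod_congr rfl hother]
    simp [matrixDerivation_X]
  simp only [totalOp, Matrix.sum_mulVec, map_sum, siteHom_apply, tensorPoly_tensorOp_mulVec, hsite]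
  simp only [tensorPoly_eq_sum_smul_prod, map_sum, Derivation.map_smul, derivation_prod,
    Finset.smul_sum]
  rw [Finset.sum_comm, eq_comm, Finset.sum_comm]
  exact Finset.sum_congr rfl fun a _ => Finset.sum_comm

/-- The operator that corresponds to multiplication by the estimator `∑_i (d + m_i) ⟨φ_i| A |φ_i⟩`:
the trace of `A` once for each colour in `ι`, plus the one-body operator of `A`. -/
def shiftedTotalOp (ι : Type*) (B : Type) [Fintype ι] [Fintype B] [DecidableEq B]
    (A : Matrix (Fin d) (Fin d) ℂ) : QuditOp B d :=
  (Fintype.card ι * A.trace) • 1 + totalOp B A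

lemma shiftedTotalOp_mulVec [Fintype ι] (A : Matrix (Fin d) (Fin d) ℂ) (v : QuditSpace B d) :
    (shiftedTotalOp ι B A).mulVec v = (Fintype.card ι * A.trace) • v + (totalOp B A).mulVec v := by
  rw [shiftedTotalOp, Matrix.add_mulVec, Matrix.smul_mulVec, Matrix.one_mulVec]

lemma tensorPoly_shiftedTotalOp_mulVec [Fintype ι] (r : B → ι)
    (A : Matrix (Fin d) (Fin d) ℂ) (v : QuditSpace B d) :
    tensorPoly r ((shiftedTotalOp ι B A).mulVec v) = ∑ i, traceShift i A (tensorPoly r v) := by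
  simp only [shiftedTotalOp_mulVec, map_add, map_smul, map_nsmul, tensorPoly_totalOp_mulVec,
    traceShift_apply, Finset.sum_add_distrib, Finset.sum_const, Finset.card_univ, mul_smul,
    Nat.cast_smul_eq_nsmul]

end

/-! ### The variance of the estimator -/

section

variable {ι : Type*} {d : ℕ} {B : Type} [Fintype B] [Fintype ι] [NeZero d]
  {A : Matrix (Fin d) (Fin d) ℂ} {r : B → ι}

/-- The estimator `∑_i (d + m_i) ⟨φ_i| A |φ_i⟩`, where `m_i` is the number of qudits of colour
`i`. -/
def colorEstimator (r : B → ι) (A : Matrix (Fin d) (Fin d) ℂ)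
    (U : ι → Matrix.unitaryGroup (Fin d) ℂ) : ℂ :=
  ∑ i, (d + fiberCount r i) * stateExpectation A i U

lemma continuous_colorEstimator (r : B → ι) (A : Matrix (Fin d) (Fin d) ℂ) :
    Continuous (colorEstimator r A) :=
  continuous_finsetSum _ fun i _ => (continuous_stateExpectation A i).const_mul _

lemma ofReal_re_colorEstimator (hA : A.IsHermitian) (r : B → ι)
    (U : ι → Matrix.unitaryGroup (Fin d) ℂ) :
    ((colorEstimator r A U).re : ℂ) = colorEstimator r A U := by
  have hconj (i : ι) := Complex.conj_eq_iff_re.2 (ofReal_re_stateExpectation hA i U)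
  rw [← Complex.conj_eq_iff_re, colorEstimator]
  simp only [map_sum, map_mul, map_add, Complex.conj_natCast, hconj]

variable [DecidableEq B]

/-- The density of the outcome, with respect to independent Haar random pure states, when the
qudits of each colour of `r` are measured jointly by the symmetric measurement in the state `v`. -/
def outcomeDensity (r : B → ι) (v : QuditSpace B d) (U : ι → Matrix.unitaryGroup (Fin d) ℂ) : ℝ :=
  (∏ i, symDim d (fiberCount r i) : ℕ) * ‖eval (braCoord U) (tensorPoly r v)‖ ^ 2

/-- The law of the random unitaries, weighted by the outcome density. -/
def weightedHaar (r : B → ι) (v : QuditSpace B d) : Measure (ι → Matrix.unitaryGroup (Fin d) ℂ) :=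
  (haarTuple ι d).withDensity fun U => ENNReal.ofReal (outcomeDensity r v U)

section

variable (r : B → ι) (v : QuditSpace B d)

lemma outcomeDensity_nonneg (U : ι → Matrix.unitaryGroup (Fin d) ℂ) : 0 ≤ outcomeDensity r v U := by
  unfold outcomeDensity; positivity

lemma ofReal_outcomeDensity (U : ι → Matrix.unitaryGroup (Fin d) ℂ) :
    (outcomeDensity r v U : ℂ) = (∏ i, symDim d (fiberCount r i) : ℕ) *
      (star (eval (braCoord U) (tensorPoly r v)) * eval (braCoord U) (tensorPoly r v)) := by
  simp [outcomeDensity, Complex.conj_mul']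

lemma continuous_outcomeDensity : Continuous (outcomeDensity r v) :=
  ((continuous_eval_braCoord _).norm.pow 2).const_mul _

instance : IsFiniteMeasure (weightedHaar r v) :=
  isFiniteMeasure_withDensity_ofReal
    ((continuous_outcomeDensity r v).integrable_of_hasCompactSupport (.of_compactSpace _)).2

lemma integral_weightedHaar (f : (ι → Matrix.unitaryGroup (Fin d) ℂ) → ℂ) :
    ∫ U, f U ∂weightedHaar r v = (∏ i, symDim d (fiberCount r i) : ℕ) *
      ∫ U, f U * (star (eval (braCoord U) (tensorPoly r v)) *
        eval (braCoord U) (tensorPoly r v)) ∂haarTuple ι d := by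
  rw [weightedHaar, integral_withDensity_eq_integral_toReal_smul
    (continuous_outcomeDensity r v).measurable.ennreal_ofReal
    (.of_forall fun U => ENNReal.ofReal_lt_top), ← integral_const_mul]
  simp only [ENNReal.toReal_ofReal (outcomeDensity_nonneg r v _), Complex.real_smul,
    ofReal_outcomeDensity]
  exact integral_congr_ae (.of_forall fun U => by ring)

end

variable {v : QuditSpace B d}

lemma integrable_weightedHaar {f : (ι → Matrix.unitaryGroup (Fin d) ℂ) → ℂ} (hf : Continuous f) :
    Integrable f (weightedHaar r v) :=
  hf.integrable_of_hasCompactSupport (.of_compactSpace f)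

lemma isProbabilityMeasure_weightedHaar (hv : IsColorSymm r v) (hunit : star v ⬝ᵥ v = 1) :
    IsProbabilityMeasure (weightedHaar r v) := by
  have hint : ∫ _, (1 : ℂ) ∂weightedHaar r v = 1 := by
    simp only [integral_weightedHaar, one_mul]
    rw [← haarInner_apply, prod_symDim_mul_haarInner_tensorPoly hv, hunit]
  rw [isProbabilityMeasure_iff_real]
  simpa using hint

lemma memLp_re_colorEstimator (r : B → ι) (A : Matrix (Fin d) (Fin d) ℂ) (v : QuditSpace B d) :
    MemLp (fun U => (colorEstimator r A U).re) 2 (weightedHaar r v) :=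
  (Complex.continuous_re.comp (continuous_colorEstimator r A)).memLp_of_hasCompactSupport
    (.of_compactSpace _)

lemma integral_colorEstimator (hv : IsColorSymm r v) (A : Matrix (Fin d) (Fin d) ℂ) :
    ∫ U, colorEstimator r A U ∂weightedHaar r v =
      star v ⬝ᵥ (shiftedTotalOp ι B A).mulVec v := by
  classical
  simp only [colorEstimator]
  rw [integral_finsetSum _ fun i _ =>
      (integrable_weightedHaar (continuous_stateExpectation A i)).const_mul _,
    ← prod_symDim_mul_haarInner_tensorPoly hv, tensorPoly_shiftedTotalOp_mulVec, map_sum,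
    Finset.mul_sum]
  refine Finset.sum_congr rfl fun i _ => ?_
  rw [integral_const_mul, integral_weightedHaar, mul_left_comm,
    integral_stateExpectation A (isWeightedHomogeneous_tensorPoly r v i)]

lemma integral_sq_colorEstimator_eq_sum (A : Matrix (Fin d) (Fin d) ℂ) :
    ∫ U, colorEstimator r A U ^ 2 ∂weightedHaar r v =
      ∑ j, ∑ i, (d + fiberCount r j) * ((d + fiberCount r i) *
        ∫ U, stateExpectation A i U * stateExpectation A j U ∂weightedHaar r v) := by
  have hint (i j : ι) : Integrable (fun U => stateExpectation A i U * stateExpectation A j U)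
      (weightedHaar r v) :=
    integrable_weightedHaar
      ((continuous_stateExpectation A i).mul (continuous_stateExpectation A j))
  have hsq (U : ι → Matrix.unitaryGroup (Fin d) ℂ) : colorEstimator r A U ^ 2 =
      ∑ j, ∑ i, (d + fiberCount r j) * ((d + fiberCount r i) *
        (stateExpectation A i U * stateExpectation A j U)) := by
    rw [colorEstimator, sq, Finset.sum_mul_sum, Finset.sum_comm]
    exact Finset.sum_congr rfl fun j _ => Finset.sum_congr rfl fun i _ => by ring
  simp only [hsq]
  rw [integral_finsetSum _ fun j _ => integrable_finsetSum _ fun i _ =>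
    ((hint i j).const_mul _).const_mul _]
  refine Finset.sum_congr rfl fun j _ => ?_
  rw [integral_finsetSum _ fun i _ => ((hint i j).const_mul _).const_mul _]
  simp only [integral_const_mul]

lemma integral_sq_colorEstimator_add (hv : IsColorSymm r v) (A : Matrix (Fin d) (Fin d) ℂ) :
    ∫ U, colorEstimator r A U ^ 2 ∂weightedHaar r v +
        ∑ i, (d + fiberCount r i) * ∫ U, stateExpectation A i U ^ 2 ∂weightedHaar r v =
      star v ⬝ᵥ (shiftedTotalOp ι B A).mulVec ((shiftedTotalOp ι B A).mulVec v) +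
        star v ⬝ᵥ (shiftedTotalOp ι B (A * A)).mulVec v := by
  classical
  have hmoment (j i : ι) := integral_stateExpectation_mul_stateExpectation A
    (isWeightedHomogeneous_tensorPoly r v i) (isWeightedHomogeneous_tensorPoly r v j)
    (tensorPoly r v)
  set κ : ℂ := ((∏ i, symDim d (fiberCount r i) : ℕ) : ℂ) with hκ
  calc ∫ U, colorEstimator r A U ^ 2 ∂weightedHaar r v +
        ∑ i, (d + fiberCount r i) * ∫ U, stateExpectation A i U ^ 2 ∂weightedHaar r v
      = ∑ j, ∑ i, (d + fiberCount r j) * ((d + fiberCount r i + if j = i then 1 else 0) *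
          ∫ U, stateExpectation A i U * stateExpectation A j U ∂weightedHaar r v) := by
        have hite (j i : ι) (x : ℂ) : (d + fiberCount r j) *
            ((d + fiberCount r i + if j = i then 1 else 0) * x) =
            (d + fiberCount r j) * ((d + fiberCount r i) * x) +
              if j = i then (d + fiberCount r j) * x else 0 := by
          split_ifs <;> ring
        simp only [hite, integral_sq_colorEstimator_eq_sum, Finset.sum_add_distrib,
          Finset.sum_ite_eq, Finset.mem_univ, if_true, sq (stateExpectation _ _ _)]
    _ = κ * ∑ j, ∑ i,
          (haarInner (tensorPoly r v) (traceShift j A (traceShift i A (tensorPoly r v))) +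
            if j = i then haarInner (tensorPoly r v) (traceShift j (A * A) (tensorPoly r v))
            else 0) := by
        simp only [← hmoment, integral_weightedHaar, ← hκ, Finset.mul_sum]
        exact Finset.sum_congr rfl fun j _ => Finset.sum_congr rfl fun i _ => by ring
    _ = _ := by
        rw [← prod_symDim_mul_haarInner_tensorPoly hv, ← prod_symDim_mul_haarInner_tensorPoly hv,
          ← mul_add]
        simp only [tensorPoly_shiftedTotalOp_mulVec, map_sum, Finset.sum_add_distrib,
          Finset.sum_ite_eq, Finset.mem_univ, if_true, hκ]

lemma ofReal_integral_re_colorEstimator (hv : IsColorSymm r v) (hA : A.IsHermitian) :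
    ((∫ U, (colorEstimator r A U).re ∂weightedHaar r v : ℝ) : ℂ) =
      star v ⬝ᵥ (shiftedTotalOp ι B A).mulVec v := by
  rw [← integral_colorEstimator hv, ← integral_complex_ofReal]
  simp only [ofReal_re_colorEstimator hA]

lemma integral_sq_re_colorEstimator_le (hv : IsColorSymm r v) (hA : A.IsHermitian) :
    ∫ U, (colorEstimator r A U).re ^ 2 ∂weightedHaar r v ≤
      (star v ⬝ᵥ (shiftedTotalOp ι B A).mulVec ((shiftedTotalOp ι B A).mulVec v)).re +
        (star v ⬝ᵥ (shiftedTotalOp ι B (A * A)).mulVec v).re := by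
  have hest (U : ι → Matrix.unitaryGroup (Fin d) ℂ) : colorEstimator r A U ^ 2 =
      (((colorEstimator r A U).re ^ 2 : ℝ) : ℂ) := by
    rw [Complex.ofReal_pow, ofReal_re_colorEstimator hA]
  have hstate (i : ι) (U : ι → Matrix.unitaryGroup (Fin d) ℂ) : stateExpectation A i U ^ 2 =
      (((stateExpectation A i U).re ^ 2 : ℝ) : ℂ) := by
    rw [Complex.ofReal_pow, ofReal_re_stateExpectation hA]
  have hadd := integral_sq_colorEstimator_add hv A
  simp only [hest, hstate, integral_complex_ofReal] at hadd
  rw [← Complex.add_re, ← hadd]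
  norm_cast
  exact le_add_of_nonneg_right <| Finset.sum_nonneg fun i _ =>
    mul_nonneg (Nat.cast_nonneg _) (integral_nonneg fun U => sq_nonneg _)

lemma variance_re_colorEstimator_le (hv : IsColorSymm r v) (hunit : star v ⬝ᵥ v = 1)
    (hA : A.IsHermitian) :
    variance (fun U => (colorEstimator r A U).re) (weightedHaar r v) ≤
      Fintype.card ι * (A * A).trace.re + Fintype.card B * specNorm (A * A) +
        (Fintype.card B) ^ 2 * specNorm A ^ 2 := by
  have := isProbabilityMeasure_weightedHaar hv hunit
  set m : ℝ := ∫ U, (colorEstimator r A U).re ∂weightedHaar r v with hm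
  set c : ℝ := Fintype.card ι * A.trace.re with hc
  have hshift : Fintype.card ι * A.trace = c := by
    have htrace : (A.trace.re : ℂ) = A.trace :=
      Complex.conj_eq_iff_re.1 (A.trace_conjTranspose.symm.trans (congrArg _ hA.eq))
    rw [hc, Complex.ofReal_mul, htrace, Complex.ofReal_natCast]
  have hmean : star v ⬝ᵥ (totalOp B A).mulVec v = ((m - c : ℝ) : ℂ) := by
    rw [Complex.ofReal_sub, hm, ofReal_integral_re_colorEstimator hv hA, shiftedTotalOp_mulVec,
      hshift, dotProduct_add, dotProduct_smul, hunit]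
    simp
  have hsecond := integral_sq_re_colorEstimator_le hv hA
  simp only [shiftedTotalOp_mulVec, hshift, Matrix.mulVec_add, Matrix.mulVec_smul, smul_add,
    dotProduct_add, dotProduct_smul, hunit, hmean, smul_eq_mul, mul_one,
    Complex.add_re, Complex.re_ofReal_mul, Complex.ofReal_re] at hsecond
  have hone := re_star_dotProduct_totalOp_mulVec_le (A * A) hunit
  have htwo := re_star_dotProduct_totalOp_mulVec_mulVec_le A hunit
  have htrace_sq : (Fintype.card ι * (A * A).trace : ℂ).re = Fintype.card ι * (A * A).trace.re := by
    rw [← Complex.ofReal_natCast, Complex.re_ofReal_mul]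
  rw [htrace_sq] at hsecond
  rw [variance_eq_sub (memLp_re_colorEstimator r A v)]
  simp only [Pi.pow_apply, ← hm]
  linarith [sq_nonneg (m - c)]

end

end

/-! ### The row-symmetric joint measurement -/

section

variable {d k : ℕ} {B : Type} [Fintype B]

lemma tensorOp_ketbra (φ : B → Fin d → ℂ) :
    tensorOp (fun b => ketbra (φ b)) = ketbra fun a => ∏ b, φ b (a b) := by
  ext a a'
  simp [tensorOp, ketbra, Matrix.vecMulVec_apply, Finset.prod_mul_distrib]

lemma trace_mul_ketbra {n : Type} [Fintype n] (M : Matrix n n ℂ) (φ : n → ℂ) :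
    (M * ketbra φ).trace = star φ ⬝ᵥ M.mulVec φ := by
  rw [ketbra, Matrix.mul_vecMulVec, Matrix.trace_vecMulVec, dotProduct_comm]

variable [DecidableEq B]

lemma permOp_mulVec (π : Equiv.Perm B) (v : QuditSpace B d) (a : B → Fin d) :
    (permOp π).mulVec v a = v (a ∘ π) := by
  simp only [Matrix.mulVec, dotProduct, permOp, Matrix.of_apply, Equiv.eq_comp_symm, ite_mul,
    one_mul, zero_mul, Finset.sum_ite_eq, Finset.mem_univ, if_true]

lemma permOp_mul (π σ : Equiv.Perm B) :
    (permOp π : QuditOp B d) * permOp σ = permOp (π * σ) := by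
  refine Matrix.mulVec_injective (funext fun v => funext fun a => ?_)
  simp only [← Matrix.mulVec_mulVec, permOp_mulVec]
  rfl

lemma tensorOp_mul_permOp (M : Matrix (Fin d) (Fin d) ℂ) (π : Equiv.Perm B) :
    tensorOp (fun _ => M) * permOp π = permOp π * tensorOp fun _ => M := by
  ext a a'
  calc (tensorOp (fun _ => M) * permOp π : QuditOp B d) a a' = ∏ b, M (a b) (a' (π.symm b)) := by
        simp [Matrix.mul_apply, permOp, tensorOp]
    _ = ∏ b, M (a (π b)) (a' b) := by
        rw [← Equiv.prod_comp π]
        simp only [Equiv.symm_apply_apply]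
    _ = (permOp π * tensorOp fun _ => M : QuditOp B d) a a' := by
        simp [Matrix.mul_apply, permOp, tensorOp, Equiv.eq_comp_symm]

lemma sum_norm_sq_tensorOp_mulVec (U : Matrix.unitaryGroup (Fin d) ℂ) (v : QuditSpace B d) :
    ∑ a, ‖(tensorOp fun _ : B => (U : Matrix (Fin d) (Fin d) ℂ)).mulVec v a‖ ^ 2 =
      ∑ a, ‖v a‖ ^ 2 := by
  have hU : (fun _ : B => (U : Matrix (Fin d) (Fin d) ℂ).conjTranspose) * (fun _ => U.1) = 1 :=
    funext fun _ => Matrix.mem_unitaryGroup_iff'.1 U.2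
  refine Complex.ofReal_injective ?_
  rw [ofReal_sum_norm_sq, ofReal_sum_norm_sq, Matrix.star_mulVec, ← Matrix.dotProduct_mulVec,
    Matrix.mulVec_mulVec, conjTranspose_tensorOp,
    tensorOp_mul, hU, tensorOp_one, Matrix.one_mulVec]

variable {lam : Fin k → ℕ}

lemma mem_rowGroup {π : Equiv.Perm (Box lam)} : π ∈ rowGroup lam ↔ ∀ b, (π b).1 = b.1 := by
  rw [rowGroup, Finset.mem_filter_univ]

lemma permOp_mul_sum_rowGroup {π : Equiv.Perm (Box lam)} (hπ : π ∈ rowGroup lam) :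
    (permOp π : QuditOp (Box lam) d) * ∑ σ ∈ rowGroup lam, permOp σ =
      ∑ σ ∈ rowGroup lam, permOp σ := by
  simp only [Finset.mul_sum, permOp_mul]
  refine Finset.sum_equiv (Equiv.mulLeft π) (fun σ => ?_) fun σ _ => rfl
  rw [mem_rowGroup] at hπ
  simp only [mem_rowGroup, Equiv.coe_mulLeft, Equiv.Perm.mul_apply, hπ]

lemma range_youngSymmetrizer_le :
    LinearMap.range (youngSymmetrizer lam d).mulVecLin ≤ rowSymSpace lam d := by
  rintro _ ⟨v, rfl⟩ π hπ
  rw [Matrix.mulVecLin_apply, Matrix.mulVec_mulVec, youngSymmetrizer, ← Matrix.mul_assoc,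
    permOp_mul_sum_rowGroup hπ]

lemma rowSymProj_mulVec {v : QuditSpace (Box lam) d} (hv : v ∈ rowSymSpace lam d) :
    (rowSymProj lam d).mulVec v = v := by
  have hcard : ((rowGroup lam).card : ℂ) ≠ 0 :=
    Nat.cast_ne_zero.2 (Finset.card_ne_zero_of_mem (mem_rowGroup.2 fun b => rfl :
      (1 : Equiv.Perm (Box lam)) ∈ rowGroup lam))
  rw [rowSymProj, Matrix.smul_mulVec, Matrix.sum_mulVec, Finset.sum_congr rfl hv,
    Finset.sum_const, ← Nat.cast_smul_eq_nsmul ℂ, inv_smul_smul₀ hcard]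

lemma tensorOp_mulVec_mem_rowSymSpace {v : QuditSpace (Box lam) d} (hv : v ∈ rowSymSpace lam d)
    (M : Matrix (Fin d) (Fin d) ℂ) : (tensorOp fun _ => M).mulVec v ∈ rowSymSpace lam d :=
  fun π hπ => by
    rw [Matrix.mulVec_mulVec, ← tensorOp_mul_permOp, ← Matrix.mulVec_mulVec, hv π hπ]

lemma isColorSymm_of_mem_rowSymSpace {v : QuditSpace (Box lam) d} (hv : v ∈ rowSymSpace lam d) :
    IsColorSymm (Sigma.fst : Box lam → Fin k) v := fun σ hσ a => by
  rw [← permOp_mulVec σ v, hv σ (mem_rowGroup.2 (congrFun hσ))]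

lemma fiberCount_fst (lam : Fin k → ℕ) (i : Fin k) :
    fiberCount (Sigma.fst : Box lam → Fin k) i = lam i := by
  rw [fiberCount_apply, Finset.card_filter, Fintype.sum_sigma, Finset.sum_eq_single i]
  · simp
  · simp +contextual
  · simp

lemma continuous_trace_povmElement_mul (ρ : QuditOp (Box lam) d) :
    Continuous fun ψ : Fin k → Matrix (Fin d) (Fin d) ℂ => (povmElement lam ψ * ρ).trace.re := by
  unfold povmElement tensorOp
  fun_prop

lemma measurable_trace_mul_estimator (O : Matrix (Fin d) (Fin d) ℂ) :
    Measurable fun ω : Outcome k d => (O * estimator lam d ω).trace := by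
  refine measurable_fun_sum (Continuous.measurable ?_) (measurable_of_finite _)
  simp only [estimator]
  fun_prop

lemma measurable_traceEstimator (O : Matrix (Fin d) (Fin d) ℂ) :
    Measurable (traceEstimator lam O : Outcome k d → ℝ) :=
  Complex.measurable_re.comp (measurable_trace_mul_estimator O)

end

section

variable {ι : Type*} {d : ℕ} [NeZero d]

/-- The tuple of random pure states `U_i |0⟩⟨0| U_i†`. -/
def pureStates (U : ι → Matrix.unitaryGroup (Fin d) ℂ) (i : ι) :
    Matrix (Fin d) (Fin d) ℂ :=
  (U i : Matrix (Fin d) (Fin d) ℂ) * ketbra (Pi.single (0 : Fin d) 1) *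
    (U i : Matrix (Fin d) (Fin d) ℂ).conjTranspose

lemma pureStates_eq_ketbra (U : ι → Matrix.unitaryGroup (Fin d) ℂ) (i : ι) :
    pureStates U i = ketbra fun x => star (braCoord U (i, x)) := by
  rw [pureStates, ketbra, Matrix.mul_vecMulVec, Matrix.vecMulVec_mul, ← Matrix.star_mulVec,
    Matrix.mulVec_single_one, ketbra]
  congr 1 <;> ext x <;> simp [braCoord]

lemma trace_mul_pureStates (O : Matrix (Fin d) (Fin d) ℂ) (i : ι)
    (U : ι → Matrix.unitaryGroup (Fin d) ℂ) :
    (O * pureStates U i).trace = stateExpectation O i U := by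
  rw [pureStates_eq_ketbra, trace_mul_ketbra, stateExpectation]
  congr 1
  ext x
  simp

lemma continuous_conj_ketbra : Continuous fun U : Matrix.unitaryGroup (Fin d) ℂ =>
    (U : Matrix (Fin d) (Fin d) ℂ) * ketbra (Pi.single (0 : Fin d) 1) *
      (U : Matrix (Fin d) (Fin d) ℂ).conjTranspose := by
  fun_prop

lemma measurable_pureStates : Measurable (pureStates (ι := ι) (d := d)) :=
  measurable_pi_lambda _ fun i =>
    continuous_conj_ketbra.measurable.comp (measurable_pi_apply i)

lemma pi_haarState [Fintype ι] :
    (Measure.pi fun _ : ι => haarState d) = (haarTuple ι d).map pureStates :=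
  have := Measure.isProbabilityMeasure_map (μ := haarUnitary d)
    (continuous_conj_ketbra (d := d)).aemeasurable
  (Measure.pi_map_pi fun _ : ι => continuous_conj_ketbra.aemeasurable).symm

end

section

variable {d k : ℕ} [NeZero d] {lam : Fin k → ℕ}

lemma measurable_inl_pureStates : Measurable fun U : Fin k → Matrix.unitaryGroup (Fin d) ℂ =>
    (Sum.inl (pureStates U) : Outcome k d) :=
  measurable_inl.comp measurable_pureStates

lemma trace_mul_estimator_pureStates (O : Matrix (Fin d) (Fin d) ℂ)
    (U : Fin k → Matrix.unitaryGroup (Fin d) ℂ) :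
    (O * estimator lam d (Sum.inl (pureStates U))).trace =
      colorEstimator (Sigma.fst : Box lam → Fin k) O U := by
  simp only [estimator, Matrix.mul_sum, Matrix.trace_sum, Matrix.mul_smul, Matrix.trace_smul,
    trace_mul_pureStates, colorEstimator, fiberCount_fst, smul_eq_mul]

lemma trace_povmElement_mul_ketbra (v : QuditSpace (Box lam) d)
    (U : Fin k → Matrix.unitaryGroup (Fin d) ℂ) :
    (povmElement lam (pureStates U) * ketbra v).trace = outcomeDensity Sigma.fst v U := by
  set z := fun a : Box lam → Fin d => ∏ b, braCoord U (b.1, a b)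
  have hstate : (tensorOp fun b : Box lam => pureStates U b.1) = ketbra (star z) := by
    simp only [pureStates_eq_ketbra, tensorOp_ketbra]
    congr 1
    ext a
    exact (map_prod (starRingEnd ℂ) _ _).symm
  have heval : MvPolynomial.eval (braCoord U) (tensorPoly Sigma.fst v) = v ⬝ᵥ z :=
    eval_tensorPoly ..
  rw [ofReal_outcomeDensity, heval, povmElement, hstate, Matrix.smul_mul, Matrix.trace_smul,
    trace_mul_ketbra, ketbra, Matrix.vecMulVec_mulVec, dotProduct_smul, op_smul_eq_mul,
    star_star, Matrix.star_dotProduct_star, dotProduct_comm z v, smul_eq_mul]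
  simp only [fiberCount_fst]

lemma withDensity_trace_povmElement_mul_ketbra (v : QuditSpace (Box lam) d) :
    (Measure.pi fun _ : Fin k => haarState d).withDensity (fun ψ =>
      ENNReal.ofReal (povmElement lam ψ * ketbra v).trace.re) =
      (weightedHaar Sigma.fst v).map pureStates := by
  ext s hs
  rw [pi_haarState, withDensity_apply _ hs, setLIntegral_map hs
    (continuous_trace_povmElement_mul _).measurable.ennreal_ofReal measurable_pureStates,
    Measure.map_apply measurable_pureStates hs, weightedHaar,
    withDensity_apply _ (measurable_pureStates hs)]
  simp only [trace_povmElement_mul_ketbra, Complex.ofReal_re]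

variable {v : QuditSpace (Box lam) d}

lemma outcomeLaw_ketbra (hv : v ∈ rowSymSpace lam d) :
    outcomeLaw lam d (ketbra v) =
      (weightedHaar Sigma.fst v).map fun U => Sum.inl (pureStates U) := by
  have hfail : ((1 - rowSymProj lam d) * ketbra v).trace = 0 := by
    rw [trace_mul_ketbra, Matrix.sub_mulVec, Matrix.one_mulVec, rowSymProj_mulVec hv, sub_self,
      dotProduct_zero]
  rw [outcomeLaw, hfail, withDensity_trace_povmElement_mul_ketbra,
    Measure.map_map measurable_inl measurable_pureStates, Complex.zero_re, ENNReal.ofReal_zero,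
    zero_smul, add_zero]
  rfl

lemma isProbabilityMeasure_outcomeLaw_ketbra (hv : v ∈ rowSymSpace lam d)
    (hunit : star v ⬝ᵥ v = 1) : IsProbabilityMeasure (outcomeLaw lam d (ketbra v)) := by
  have := isProbabilityMeasure_weightedHaar (isColorSymm_of_mem_rowSymSpace hv) hunit
  rw [outcomeLaw_ketbra hv]
  exact Measure.isProbabilityMeasure_map measurable_inl_pureStates.aemeasurable

lemma outcomeLaw_ketbra_fail (hv : v ∈ rowSymSpace lam d) :
    outcomeLaw lam d (ketbra v) {Sum.inr ()} = 0 := by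
  have hfail : MeasurableSet ({Sum.inr ()} : Set (Outcome k d)) := by
    rw [← Set.image_singleton]
    exact (measurableSet_singleton ()).inr_image
  rw [outcomeLaw_ketbra hv, Measure.map_apply measurable_inl_pureStates hfail]
  convert measure_empty (μ := weightedHaar Sigma.fst v)
  ext U
  simp

variable {O : Matrix (Fin d) (Fin d) ℂ}

lemma ae_trace_mul_estimator_eq (hv : v ∈ rowSymSpace lam d) (hO : O.IsHermitian) :
    ∀ᵐ ω ∂outcomeLaw lam d (ketbra v),
      (O * estimator lam d ω).trace = (traceEstimator lam O ω : ℂ) := by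
  have hmeas : MeasurableSet {ω : Outcome k d |
      (O * estimator lam d ω).trace = (traceEstimator lam O ω : ℂ)} :=
    measurableSet_eq_fun (measurable_trace_mul_estimator O)
      (Complex.measurable_ofReal.comp (measurable_traceEstimator O))
  rw [outcomeLaw_ketbra hv, ae_map_iff measurable_inl_pureStates.aemeasurable hmeas]
  refine .of_forall fun U => ?_
  rw [traceEstimator, trace_mul_estimator_pureStates, ofReal_re_colorEstimator hO]

lemma memLp_traceEstimator (hv : v ∈ rowSymSpace lam d) (O : Matrix (Fin d) (Fin d) ℂ) :
    MemLp (traceEstimator lam O) 2 (outcomeLaw lam d (ketbra v)) := by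
  rw [outcomeLaw_ketbra hv, memLp_map_measure_iff
    (measurable_traceEstimator O).aestronglyMeasurable measurable_inl_pureStates.aemeasurable]
  simpa only [Function.comp_def, traceEstimator, trace_mul_estimator_pureStates]
    using memLp_re_colorEstimator Sigma.fst O v

lemma variance_traceEstimator_le (hv : v ∈ rowSymSpace lam d) (hunit : star v ⬝ᵥ v = 1)
    (hO : O.IsHermitian) :
    variance (traceEstimator lam O) (outcomeLaw lam d (ketbra v)) ≤
      k * (O * O).trace.re + (∑ i, lam i : ℕ) * specNorm (O * O) +
        (∑ i, lam i : ℕ) ^ 2 * specNorm O ^ 2 := by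
  rw [outcomeLaw_ketbra hv, variance_map (measurable_traceEstimator O).aemeasurable
    measurable_inl_pureStates.aemeasurable]
  simpa [Function.comp_def, traceEstimator, trace_mul_estimator_pureStates]
    using variance_re_colorEstimator_le (isColorSymm_of_mem_rowSymSpace hv) hunit hO

end

end RowSymShadow

end

theorem mainTheorem4_general {d k : ℕ} [NeZero d] {lam : Fin k → ℕ} {v : QuditSpace (Box lam) d}
    (hv : v ∈ rowSymSpace lam d) (hunit : ∑ a, ‖v a‖ ^ 2 = 1) {O : Matrix (Fin d) (Fin d) ℂ}
    (hO : O.IsHermitian) :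
    IsProbabilityMeasure (outcomeLaw lam d (ketbra v)) ∧
      outcomeLaw lam d (ketbra v) {Sum.inr ()} = 0 ∧
      (∀ᵐ ω ∂outcomeLaw lam d (ketbra v),
        (O * estimator lam d ω).trace = (traceEstimator lam O ω : ℂ)) ∧
      MemLp (traceEstimator lam O) 2 (outcomeLaw lam d (ketbra v)) ∧
      variance (traceEstimator lam O) (outcomeLaw lam d (ketbra v)) =
        (∫ ω, traceEstimator lam O ω ^ 2 ∂outcomeLaw lam d (ketbra v)) -
          (∫ ω, traceEstimator lam O ω ∂outcomeLaw lam d (ketbra v)) ^ 2 ∧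
      variance (traceEstimator lam O) (outcomeLaw lam d (ketbra v)) ≤
        k * (O * O).trace.re + (∑ i, lam i : ℕ) * specNorm (O * O) +
          (∑ i, lam i : ℕ) ^ 2 * specNorm O ^ 2 := by
  have hdot : star v ⬝ᵥ v = 1 := by rw [← ofReal_sum_norm_sq, hunit, Complex.ofReal_one]
  have hprob := isProbabilityMeasure_outcomeLaw_ketbra hv hdot
  have hmem := memLp_traceEstimator hv O
  exact ⟨hprob, outcomeLaw_ketbra_fail hv, ae_trace_mul_estimator_eq hv hO, hmem,
    variance_eq_sub hmem, variance_traceEstimator_le hv hdot hO⟩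

theorem mainTheorem4 :
    ∃ C₁ C₂ : ℝ, ∀ (d n k : ℕ) [NeZero d] (lam : Fin k → ℕ),
      Antitone lam → (∀ i, 0 < lam i) → ∑ i, lam i = n → k ≤ d →
      LinearMap.range (youngSymmetrizer lam d).mulVecLin ≤ rowSymSpace lam d ∧
      ∀ (w : Fin d → ℕ) (τ : QuditSpace (Box lam) d) (U : Matrix.unitaryGroup (Fin d) ℂ)
        (O : Matrix (Fin d) (Fin d) ℂ) (P : Measure (Outcome k d)) (X : Outcome k d → ℝ),
        τ ∈ weightSpace w → τ ∈ rowSymSpace lam d → ∑ a, ‖τ a‖ ^ 2 = 1 → O.IsHermitian →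
        P = outcomeLaw lam d (rotatedState U τ) → X = traceEstimator lam O →
        IsProbabilityMeasure P ∧ P {Sum.inr ()} = 0 ∧
          (∀ᵐ ω ∂P, (O * estimator lam d ω).trace = (X ω : ℂ)) ∧
          MemLp X 2 P ∧
          variance X P = (∫ ω, X ω ^ 2 ∂P) - (∫ ω, X ω ∂P) ^ 2 ∧
          variance X P ≤ (k : ℝ) * (O * O).trace.re + C₁ * n * specNorm (O * O)
            + C₂ * (n : ℝ) ^ 2 * specNorm O ^ 2 := by
  refine ⟨1, 1, fun d n k _ lam _ _ hn _ => ⟨range_youngSymmetrizer_le, ?_⟩⟩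
  rintro w τ U O _ _ - hτ hunit hO rfl rfl
  simpa only [rotatedState, one_mul, hn] using mainTheorem4_general
    (tensorOp_mulVec_mem_rowSymSpace hτ U) ((sum_norm_sq_tensorOp_mulVec U τ).trans hunit) hO
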